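/- Let $G$ be a countable abelian group and let $P\subseteq G$ be a subsemigroup containing the identity $e$. A product system over $P$ of finite-dimensional Hilbert spaces is a family $E=(E_s)_{s\in P}$ of nonzero finite-dimensional complex Hilbert spaces with $\dim E_e=1$, together with an associative multiplication on $\bigsqcup_{s} E_s$ (also denoted $E$) such that $x\otimes y\mapsto xy$ extends to a unitary isomorphism $E_s\otimes E_t\to E_{st}$ for all $s,t\in P$; it then has an identity $1\in E_e$. A Cuntz representation of $E$ in a $C^*$-algebra $B$ is a map $\varphi:E\to B$ such that - $\varphi(xy)=\varphi(x)\varphi(y)$ for all $x,y\in E$, - $\varphi(y)^*\varphi(x)=(x\mid y)\,\varphi(1)$ whenever $x,y$ lie in the same fiber (the inner product being linear in the first variable), - $\sum_{f\in\mathcal B}\varphi(f)\varphi(f)^*=\varphi(1)$ for every $t\in P$ and every orthonormal basis $\mathcal B$ of $E_t$. Let $\mathcal O_E$ be the $C^*$-algebra generated by a universal Cuntz representation $i_E:E\to\mathcal O_E$; that is, $i_E$ is a Cuntz representation, $i_E(E)$ generates $\mathcal O_E$ as a $C^*$-algebra, and every Cuntz representation $\varphi$ of $E$ in a $C^*$-algebra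 $B$ is of the form $\varphi=\varphi_*\circ i_E$ for a $*$-homomorphism $\varphi_*:\mathcal O_E\to B$. Theorem. Suppose that $E$ admits a nonzero Cuntz representation and that the dimension function $s\mapsto\dim E_s$ is injective on $P$. Then $\mathcal O_E$ is simple (it is nonzero and has no closed two-sided ideals other than $0$ and $\mathcal O_E$). If moreover $P\neq\{e\}$, then $\mathcal O_E$ is purely infinite: every nonzero hereditary $C^*$-subalgebra of $\mathcal O_E$ contains an infinite projection, i.e. a projection that is Murray–von Neumann equivalent to a proper subprojection of itself. -/

import Mathlib

open scoped TensorProduct ENNReal InnerProductSpace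

/-- A `C*`-algebra is simple if it is nonzero and has no closed two-sided ideals besides `{0}` and
itself. -/
def IsSimpleCStarAlgebra (A : Type*) [NonUnitalCStarAlgebra A] : Prop :=
  Nontrivial A ∧ ∀ I : TwoSidedIdeal A, IsClosed (I : Set A) → I = ⊥ ∨ I = ⊤

/-- A hereditary `C*`-subalgebra: a norm-closed `*`-subalgebra `H` such that `0 ≤ a ≤ b` and `b ∈ H`
imply `a ∈ H`. Here `x ≤ y` means that `y - x` is of the form `c* c`. -/
structure IsHereditary {A : Type*} [NonUnitalCStarAlgebra A] (H : NonUnitalStarSubalgebra ℂ A) :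
    Prop where
  isClosed : IsClosed (H : Set A)
  mem_of_le : ∀ a b : A, b ∈ H → (∃ c, a = star c * c) → (∃ d, b - a = star d * d) → a ∈ H

/-- A projection is infinite if it is Murray-von Neumann equivalent to a proper subprojection of
itself: there is `v` with `v* v = p`, `v v* ≤ p` and `v v* ≠ p`. -/
def IsInfiniteProjection {A : Type*} [NonUnitalCStarAlgebra A] (p : A) : Prop :=
  IsStarProjection p ∧ ∃ v : A, star v * v = p ∧ p * (v * star v) = v * star v ∧ v * star v ≠ p

/-- A (simple) `C*`-algebra is purely infinite if every nonzero hereditary `C*`-subalgebra contains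
an infinite projection. -/
def IsPurelyInfinite (A : Type*) [NonUnitalCStarAlgebra A] : Prop :=
  ∀ H : NonUnitalStarSubalgebra ℂ A, IsHereditary H → H ≠ ⊥ → ∃ p ∈ H, IsInfiniteProjection p

section CStarFacts

open scoped ComplexOrder

/-- In a `C*`-algebra, every nonzero element is seen by a positive functional. -/
theorem exists_positiveLinearMap_ne_zero {A : Type*} [NonUnitalCStarAlgebra A] [PartialOrder A]
    [StarOrderedRing A] {a : A} (ha : a ≠ 0) :
    ∃ f : A →ₚ[ℂ] ℂ, f (star a * a) ≠ 0 := by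
  let : NormedSpace ℝ A := NormedSpace.complexToReal
  have hnot : -(star a * a) ∉ {b : A | 0 ≤ b} := by
    intro h
    have h1 : star a * a ≤ 0 := neg_nonneg.1 h
    exact ha ((CStarRing.star_mul_self_eq_zero_iff a).1 (le_antisymm h1 (star_mul_self_nonneg a)))
  have hconv : Convex ℝ {b : A | 0 ≤ b} := by
    intro x hx y hy s t hs ht _
    exact add_nonneg (smul_nonneg hs hx) (smul_nonneg ht hy)
  obtain ⟨g, r, hg, hr⟩ := geometric_hahn_banach_point_closed hconv
    (CStarAlgebra.isClosed_nonneg (A := A)) hnot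
  have hr0 : r < 0 := by simpa using hr 0 (le_refl (0 : A))
  have hpos : ∀ b : A, 0 ≤ b → 0 ≤ g b := by
    intro b hb
    by_contra! hlt
    have h1 := hr ((r / g b) • b) (smul_nonneg (div_nonneg_of_nonpos hr0.le hlt.le) hb)
    rw [map_smul, smul_eq_mul, div_mul_cancel₀ _ hlt.ne] at h1
    exact lt_irrefl _ h1
  let f0 : A →ₗ[ℂ] ℂ :=
    { toFun := fun b ↦ ⟨g (b + star b), -g (Complex.I • b + star (Complex.I • b))⟩
      map_add' := by
        intro x y
        apply Complex.ext
        · simp; ring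
        · simp; ring
      map_smul' := by
        intro c x
        have hc : ∀ z : A, c • z = c.re • z + c.im • (Complex.I • z) := by
          intro z
          conv_lhs => rw [← Complex.re_add_im c, add_smul, mul_smul]
          simp
        have hI : ∀ (s : ℝ) (z : A), Complex.I • (s • z) = s • (Complex.I • z) := fun s z ↦
          smul_comm _ _ _
        have hII : Complex.I • (Complex.I • x) = -x := by rw [smul_smul]; simp
        apply Complex.ext
        · simp only [RingHom.id_apply, smul_eq_mul, Complex.mul_re]
          rw [hc x]
          simp only [star_add, star_smul, map_add, map_smul, smul_eq_mul, star_trivial,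
            Complex.star_def, Complex.conj_I]
          ring
        · simp only [RingHom.id_apply, smul_eq_mul, Complex.mul_im]
          rw [hc x, smul_add, hI, hI, hII]
          simp only [star_add, star_smul, map_add, map_smul, smul_eq_mul, star_trivial,
            Complex.star_def, Complex.conj_I, star_neg, map_neg]
          ring }
  have hf0 : ∀ b : A, IsSelfAdjoint b → f0 b = ((2 * g b : ℝ) : ℂ) := by
    intro b hb
    apply Complex.ext
    · change g (b + star b) = _
      rw [hb.star_eq, map_add, Complex.ofReal_re]; ring
    · change -g (Complex.I • b + star (Complex.I • b)) = _
      rw [star_smul, hb.star_eq, Complex.star_def, Complex.conj_I, neg_smul, add_neg_cancel]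
      simp
  refine ⟨PositiveLinearMap.mk₀ f0 ?_, ?_⟩
  · intro b hb
    rw [hf0 b (.of_nonneg hb)]
    exact_mod_cast mul_nonneg zero_le_two (hpos b hb)
  · change f0 _ ≠ 0
    rw [hf0 _ (.star_mul_self a)]
    have : g (-(star a * a)) < 0 := hg.trans hr0
    rw [map_neg] at this
    have h2 : (2 * g (star a * a) : ℝ) ≠ 0 := by
      intro h
      linarith
    exact_mod_cast h2

/-- An orthonormal set in a separable inner product space is countable. -/
theorem countable_of_orthonormal {H : Type*} [NormedAddCommGroup H] [InnerProductSpace ℂ H]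
    [TopologicalSpace.SeparableSpace H] {w : Set H} (hw : Orthonormal ℂ ((↑) : w → H)) :
    w.Countable := by
  refine Set.PairwiseDisjoint.countable_of_isOpen (s := fun x ↦ Metric.ball x (1 / 2)) ?_
    (fun _ _ ↦ Metric.isOpen_ball) (fun x _ ↦ ⟨x, Metric.mem_ball_self (by norm_num)⟩)
  intro x hx y hy hxy
  refine Metric.ball_disjoint_ball ?_
  have h0 : ⟪x, y⟫_ℂ = 0 := hw.2 (i := ⟨x, hx⟩) (j := ⟨y, hy⟩) (by simpa using hxy)
  have h1 := norm_sub_sq (𝕜 := ℂ) x y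
  have hx1 : ‖x‖ = 1 := hw.1 ⟨x, hx⟩
  have hy1 : ‖y‖ = 1 := hw.1 ⟨y, hy⟩
  rw [h0, hx1, hy1, map_zero] at h1
  rw [dist_eq_norm]
  nlinarith [norm_nonneg (x - y)]

/-- A separable Hilbert space embeds isometrically in `ℓ²(ℕ)`. -/
theorem exists_linearIsometry_lp {H : Type*} [NormedAddCommGroup H] [InnerProductSpace ℂ H]
    [CompleteSpace H] [TopologicalSpace.SeparableSpace H] :
    Nonempty (H →ₗᵢ[ℂ] lp (fun _ : ℕ ↦ ℂ) 2) := by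
  obtain ⟨w, b, hb⟩ := exists_hilbertBasis ℂ H
  have hw : Countable w := (countable_of_orthonormal (hb ▸ b.orthonormal)).to_subtype
  obtain ⟨e, he⟩ := hw.exists_injective_nat
  let b0 : HilbertBasis ℕ ℂ (lp (fun _ : ℕ ↦ ℂ) 2) := ⟨LinearIsometryEquiv.refl ℂ _⟩
  exact ⟨(b0.orthonormal.comp e he).orthogonalFamily.linearIsometry.comp
    b.repr.toLinearIsometry⟩

/-- Every nonzero element of a separable `C*`-algebra is nonzero in some representation on
`ℓ²(ℕ)`. -/
theorem exists_representation_ne_zero {A : Type*} [NonUnitalCStarAlgebra A]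
    [TopologicalSpace.SeparableSpace A] {a : A} (ha : a ≠ 0) :
    ∃ ρ : A →⋆ₙₐ[ℂ] (lp (fun _ : ℕ ↦ ℂ) 2 →L[ℂ] lp (fun _ : ℕ ↦ ℂ) 2), ρ a ≠ 0 := by
  let := CStarAlgebra.spectralOrder A
  have := CStarAlgebra.spectralOrderedRing A
  have ha' : a * star a ≠ 0 := mt (CStarRing.mul_star_self_eq_zero_iff a).1 ha
  obtain ⟨f, hf⟩ := exists_positiveLinearMap_ne_zero ha'
  obtain ⟨C, hC⟩ := f.exists_norm_apply_le
  let L : A →L[ℂ] f.PreGNS := f.toPreGNS.toLinearMap.mkContinuous (Real.sqrt C) (by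
    intro x
    change ‖f.toPreGNS x‖ ≤ _
    rw [f.preGNS_norm_def]
    rw [← Real.sqrt_sq (norm_nonneg x), ← Real.sqrt_mul C.coe_nonneg]
    refine Real.sqrt_le_sqrt ((Complex.re_le_norm _).trans ((hC _).trans ?_))
    rw [f.ofPreGNS_toPreGNS, CStarRing.norm_star_mul_self, sq])
  have hL : Function.Surjective L := fun y ↦ ⟨f.ofPreGNS y, rfl⟩
  have : TopologicalSpace.SeparableSpace f.PreGNS := hL.denseRange.separableSpace L.continuous
  obtain ⟨V⟩ := exists_linearIsometry_lp (H := f.GNS)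
  have hV : ∀ x, ContinuousLinearMap.adjoint V.toContinuousLinearMap (V x) = x := by
    intro x
    refine ext_inner_right ℂ fun y ↦ ?_
    rw [ContinuousLinearMap.adjoint_inner_left]
    exact V.inner_map_map x y
  let ρ : A →⋆ₙₐ[ℂ] (lp (fun _ : ℕ ↦ ℂ) 2 →L[ℂ] lp (fun _ : ℕ ↦ ℂ) 2) :=
    { toFun := fun x ↦ V.toContinuousLinearMap ∘L (f.gnsNonUnitalStarAlgHom x) ∘L
        ContinuousLinearMap.adjoint V.toContinuousLinearMap
      map_smul' := by intro c x; ext1 y; simp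
      map_zero' := by ext1 y; simp
      map_add' := by intro x y; ext1 z; simp
      map_mul' := by
        intro x y; ext1 z
        simp [hV]
      map_star' := by
        intro x
        rw [map_star, ContinuousLinearMap.star_eq_adjoint, ContinuousLinearMap.star_eq_adjoint,
          ContinuousLinearMap.adjoint_comp, ContinuousLinearMap.adjoint_comp,
          ContinuousLinearMap.adjoint_adjoint]
        rfl }
  refine ⟨ρ, fun h ↦ hf ?_⟩
  have h1 : f.gnsNonUnitalStarAlgHom a ((f.toPreGNS (star a) : f.PreGNS) : f.GNS) = 0 := by
    have h2 := congrArg (fun T ↦ ContinuousLinearMap.adjoint V.toContinuousLinearMap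
      (T (V ((f.toPreGNS (star a) : f.PreGNS) : f.GNS)))) h
    simpa [ρ, hV] using h2
  rw [f.gnsNonUnitalStarAlgHom_apply_coe, f.leftMulMapPreGNS_apply] at h1
  have h3 := congrArg norm h1
  rw [UniformSpace.Completion.norm_coe, norm_zero] at h3
  have h4 := f.preGNS_norm_sq (f.toPreGNS (a * star a))
  simp only [f.ofPreGNS_toPreGNS] at h3 h4
  rw [← h4]
  have h5 : ‖f.toPreGNS (a * star a)‖ = 0 := h3
  rw [h5]; simp

/-- The `C*`-algebra generated by a separable set is separable. -/
theorem isSeparable_closure_adjoin {A : Type*} [NonUnitalCStarAlgebra A] {s : Set A}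
    (hs : TopologicalSpace.IsSeparable s) : TopologicalSpace.IsSeparable
      ((NonUnitalStarAlgebra.adjoin ℂ s).topologicalClosure : Set A) := by
  obtain ⟨t, ht, hst⟩ := hs
  have h1 : (NonUnitalStarAlgebra.adjoin ℂ s).topologicalClosure ≤
      (NonUnitalStarAlgebra.adjoin ℂ t).topologicalClosure :=
    NonUnitalStarSubalgebra.topologicalClosure_minimal _
      (NonUnitalStarAlgebra.adjoin_le (hst.trans
        (closure_mono (NonUnitalStarAlgebra.subset_adjoin ℂ t))))
      (NonUnitalStarSubalgebra.isClosed_topologicalClosure _)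
  refine TopologicalSpace.IsSeparable.mono ?_ h1
  change TopologicalSpace.IsSeparable (closure (NonUnitalStarAlgebra.adjoin ℂ t : Set A))
  refine TopologicalSpace.IsSeparable.closure ?_
  have h2 : (NonUnitalStarAlgebra.adjoin ℂ t : Set A) =
      (Submodule.span ℂ (Subsemigroup.closure (t ∪ star t) : Set A) : Set A) := by
    rw [← NonUnitalStarAlgebra.adjoin_eq_span]; rfl
  rw [h2]
  refine TopologicalSpace.IsSeparable.span (Set.Countable.isSeparable ?_)
  have hu : (t ∪ star t).Countable := ht.union (by
    rw [← Set.image_star]; exact ht.image _)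
  have := hu.to_subtype
  refine (Set.countable_range (fun p : (t ∪ star t : Set A) × List (t ∪ star t : Set A) ↦
    p.2.foldl (fun (x : A) (y : (t ∪ star t : Set A)) ↦ x * (y : A)) (p.1 : A))).mono ?_
  have hfold : ∀ (l : List (t ∪ star t : Set A)) (x y : A),
      l.foldl (fun (x : A) (y : (t ∪ star t : Set A)) ↦ x * (y : A)) (x * y) = x * l.foldl (fun (x : A) (y : (t ∪ star t : Set A)) ↦ x * (y : A)) y := by
    intro l
    induction l with
    | nil => intro x y; rfl
    | cons a l ih => intro x y; simp only [List.foldl_cons]; rw [mul_assoc, ih]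
  intro x hx
  induction hx using Subsemigroup.closure_induction with
  | mem x hx => exact ⟨(⟨x, hx⟩, []), rfl⟩
  | mul x y _ _ hx hy =>
    obtain ⟨⟨a, l⟩, rfl⟩ := hx
    obtain ⟨⟨b, m⟩, rfl⟩ := hy
    refine ⟨(a, l ++ b :: m), ?_⟩
    simp only [List.foldl_append, List.foldl_cons]
    rw [hfold]

end CStarFacts

/-- A product system of finite-dimensional Hilbert spaces over a discrete monoid `P`: a family
`E_s` (`s ∈ P`) of nonzero finite-dimensional complex Hilbert spaces, with `dim E_1 = 1`, and an
associative multiplication `E_s × E_t → E_{st}` such that `x ⊗ y ↦ x y` is a unitary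
isomorphism `E_s ⊗ E_t → E_{st}`. (As the spaces are finite-dimensional, the algebraic tensor
product with its inner product is the Hilbert space tensor product.) -/
structure ProductSystem.{u, v} (P : Type v) [Monoid P] where
  Fiber : P → Type u
  [normedAddCommGroup : ∀ s, NormedAddCommGroup (Fiber s)]
  [innerProductSpace : ∀ s, InnerProductSpace ℂ (Fiber s)]
  [finiteDimensional : ∀ s, FiniteDimensional ℂ (Fiber s)]
  [nontrivial : ∀ s, Nontrivial (Fiber s)]
  /-- The unitary `E_s ⊗ E_t → E_{st}` that implements the multiplication. -/
  mulIso : ∀ s t, Fiber s ⊗[ℂ] Fiber t ≃ₗᵢ[ℂ] Fiber (s * t)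
  /-- `(x y) z = x (y z)`, as an equality in the disjoint union of the fibers. -/
  mul_assoc' : ∀ {r s t : P} (x : Fiber r) (y : Fiber s) (z : Fiber t),
    (⟨r * s * t, mulIso (r * s) t (mulIso r s (x ⊗ₜ[ℂ] y) ⊗ₜ[ℂ] z)⟩ : Σ a, Fiber a) =
      ⟨r * (s * t), mulIso r (s * t) (x ⊗ₜ[ℂ] mulIso s t (y ⊗ₜ[ℂ] z))⟩
  finrank_fiber_one : Module.finrank ℂ (Fiber 1) = 1

namespace ProductSystem

attribute [instance] normedAddCommGroup innerProductSpace finiteDimensional nontrivial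

universe u v w

variable {P : Type v} [Monoid P] (E : ProductSystem.{u, v} P)

/-- The total space of a product system, the disjoint union of its fibers; the projection
`E → P` is `Sigma.fst`. -/
def Total : Type (max u v) := Σ s, E.Fiber s

variable {E}

/-- A vector of the fiber `E_s` as an element of the total space. -/
def of {s : P} (x : E.Fiber s) : E.Total := ⟨s, x⟩

/-- The multiplication of the total space. -/
noncomputable instance : Semigroup E.Total where
  mul x y := of (E.mulIso x.1 y.1 (x.2 ⊗ₜ[ℂ] y.2))
  mul_assoc x y z := E.mul_assoc' x.2 y.2 z.2

theorem of_mul_of {s t : P} (x : E.Fiber s) (y : E.Fiber t) :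
    of x * of y = of (E.mulIso s t (x ⊗ₜ[ℂ] y)) := rfl

theorem of_injective {s : P} : Function.Injective (of : E.Fiber s → E.Total) :=
  sigma_mk_injective

theorem of_cast {s t : P} (h : s = t) (x : E.Fiber s) : of (h ▸ x : E.Fiber t) = of x := by
  subst h; rfl

theorem norm_cast_fiber {s t : P} (h : s = t) (x : E.Fiber s) :
    ‖(h ▸ x : E.Fiber t)‖ = ‖x‖ := by
  subst h; rfl

theorem of_mul_left_cancel {s : P} {u : E.Fiber 1} (hu : u ≠ 0) {x y : E.Fiber s}
    (h : of u * of x = of u * of y) : x = y := by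
  have h1 : E.mulIso 1 s (u ⊗ₜ[ℂ] x) = E.mulIso 1 s (u ⊗ₜ[ℂ] y) := of_injective h
  have h2 : u ⊗ₜ[ℂ] (x - y) = 0 := by
    rw [TensorProduct.tmul_sub, (E.mulIso 1 s).injective h1, sub_self]
  have h3 : ‖u‖ * ‖x - y‖ = 0 := by rw [← TensorProduct.norm_tmul (𝕜 := ℂ), h2, norm_zero]
  rcases mul_eq_zero.1 h3 with h4 | h4
  · exact absurd (norm_eq_zero.1 h4) hu
  · exact sub_eq_zero.1 (norm_eq_zero.1 h4)

theorem of_mul_right_cancel {s : P} {u : E.Fiber 1} (hu : u ≠ 0) {x y : E.Fiber s}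
    (h : of x * of u = of y * of u) : x = y := by
  have h1 : E.mulIso s 1 (x ⊗ₜ[ℂ] u) = E.mulIso s 1 (y ⊗ₜ[ℂ] u) := of_injective h
  have h2 : (x - y) ⊗ₜ[ℂ] u = 0 := by
    rw [TensorProduct.sub_tmul, (E.mulIso s 1).injective h1, sub_self]
  have h3 : ‖x - y‖ * ‖u‖ = 0 := by rw [← TensorProduct.norm_tmul (𝕜 := ℂ), h2, norm_zero]
  rcases mul_eq_zero.1 h3 with h4 | h4
  · exact sub_eq_zero.1 (norm_eq_zero.1 h4)
  · exact absurd (norm_eq_zero.1 h4) hu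

variable (E)

/-- Since `dim E_1 = 1`, the multiplication has an identity, which lies in `E_1`. -/
theorem exists_one : ∃ u : E.Fiber 1, ∀ z : E.Total, of u * z = z ∧ z * of u = z := by
  obtain ⟨a, ha, hspan⟩ := finrank_eq_one_iff'.1 E.finrank_fiber_one
  obtain ⟨c, hc⟩ := hspan (one_mul (1 : P) ▸ E.mulIso 1 1 (a ⊗ₜ[ℂ] a))
  have hc' : of (c • a) = of a * of a := by rw [hc, of_cast, of_mul_of]
  have hc0 : c ≠ 0 := by
    rintro rfl
    have h := norm_cast_fiber (one_mul (1 : P)) (E.mulIso 1 1 (a ⊗ₜ[ℂ] a))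
    rw [← hc, LinearIsometryEquiv.norm_map, TensorProduct.norm_tmul, zero_smul, norm_zero] at h
    have := norm_pos_iff.2 ha
    nlinarith
  have hmul : ∀ (d : ℂ) {s t : P} (x : E.Fiber s) (y : E.Fiber t) (z : E.Fiber (s * t)),
      of x * of y = of z → of (d • x) * of y = of (d • z) ∧ of x * of (d • y) = of (d • z) := by
    intro d s t x y z h
    have h' : E.mulIso s t (x ⊗ₜ[ℂ] y) = z := of_injective h
    constructor
    · rw [of_mul_of, ← TensorProduct.smul_tmul', map_smul, h']
    · rw [of_mul_of, TensorProduct.tmul_smul, map_smul, h']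
  have hu0 : c⁻¹ • a ≠ 0 := smul_ne_zero (inv_ne_zero hc0) ha
  have hidem : of (c⁻¹ • a) * of (c⁻¹ • a) = of (c⁻¹ • a) := by
    have h1 := (hmul c⁻¹ a a _ rfl).1
    have h2 := (hmul c⁻¹ (c⁻¹ • a) a _ h1).2
    rw [h2]
    have hcast : ∀ {s t : P} (h : s = t) (d : ℂ) (x : E.Fiber s) (y : E.Fiber t),
        of x = of y → of (d • x) = of (d • y) := by
      rintro s t rfl d x y hxy
      rw [of_injective hxy]
    have h3 : of (E.mulIso 1 1 (a ⊗ₜ[ℂ] a)) = of (c • a) := hc'.symm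
    have h4 := hcast (one_mul 1) c⁻¹ _ _ (hcast (one_mul 1) c⁻¹ _ _ h3)
    rw [inv_smul_smul₀ hc0] at h4
    exact h4
  refine ⟨c⁻¹ • a, fun z ↦ ?_⟩
  obtain ⟨s, z⟩ := z
  constructor
  · have h1 : of (one_mul s ▸ E.mulIso 1 s ((c⁻¹ • a) ⊗ₜ[ℂ] z)) = of (c⁻¹ • a) * of z := by
      rw [of_cast, of_mul_of]
    have h2 : (one_mul s ▸ E.mulIso 1 s ((c⁻¹ • a) ⊗ₜ[ℂ] z) : E.Fiber s) = z := by
      apply of_mul_left_cancel hu0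
      rw [h1, ← mul_assoc, hidem]
    rw [h2] at h1
    exact h1.symm
  · have h1 : of (mul_one s ▸ E.mulIso s 1 (z ⊗ₜ[ℂ] (c⁻¹ • a))) = of z * of (c⁻¹ • a) := by
      rw [of_cast, of_mul_of]
    have h2 : (mul_one s ▸ E.mulIso s 1 (z ⊗ₜ[ℂ] (c⁻¹ • a)) : E.Fiber s) = z := by
      apply of_mul_right_cancel hu0
      rw [h1, mul_assoc, hidem]
    rw [h2] at h1
    exact h1.symm

/-- The identity `1 ∈ E_1` of a product system. -/
noncomputable def one : E.Fiber 1 := E.exists_one.choose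

/-- The total space is a monoid, with the identity of `E_1` as its identity. -/
noncomputable instance : Monoid E.Total where
  one := of E.one
  one_mul z := (E.exists_one.choose_spec z).1
  mul_one z := (E.exists_one.choose_spec z).2

theorem one_def : (1 : E.Total) = of E.one := rfl

theorem norm_one : ‖E.one‖ = 1 := by
  have h : (1 : E.Total) * 1 = 1 := mul_one 1
  rw [one_def, of_mul_of, ← of_cast (one_mul (1 : P))] at h
  have h1 := congrArg norm (of_injective h)
  rw [norm_cast_fiber, LinearIsometryEquiv.norm_map, TensorProduct.norm_tmul] at h1
  have h0 : E.one ≠ 0 := by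
    intro h0
    obtain ⟨x, hx⟩ := exists_ne (0 : E.Fiber 1)
    have h2 : of E.one * of x = of E.one * of (0 : E.Fiber 1) := by
      rw [h0, of_mul_of, of_mul_of]; simp
    have h3 : (1 : E.Total) * of x = 1 * of (0 : E.Fiber 1) := h2
    rw [one_mul, one_mul] at h3
    exact hx (of_injective h3)
  exact mul_left_cancel₀ (norm_ne_zero_iff.2 h0) (h1.trans (mul_one _).symm)

/-- A representation of `E` in a (possibly non-unital) `C*`-algebra `B`: a map `φ : E → B` with
`φ(xy) = φ(x) φ(y)` for all `x, y ∈ E`, and `φ(y)* φ(x) = (x | y) φ(1)` for `x, y` in the same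
fiber, where `(x | y)` is linear in `x` (this is `inner ℂ y x`). -/
structure IsRepresentation {B : Type w} [NonUnitalCStarAlgebra B] (φ : E.Total → B) : Prop where
  map_mul : ∀ x y, φ (x * y) = φ x * φ y
  star_mul : ∀ {s : P} (x y : E.Fiber s), star (φ (of y)) * φ (of x) = ⟪y, x⟫_ℂ • φ 1

/-- A Cuntz representation: a representation `φ` with `∑_{f ∈ 𝓑} φ(f) φ(f)* = φ(1)` for every
orthonormal basis `𝓑` of every fiber. -/
structure IsCuntzRepresentation {B : Type w} [NonUnitalCStarAlgebra B] (φ : E.Total → B) : Prop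
    extends E.IsRepresentation φ where
  sum_mul_star : ∀ (t : P) (b : OrthonormalBasis (Fin (Module.finrank ℂ (E.Fiber t))) ℂ
    (E.Fiber t)), ∑ i, φ (of (b i)) * star (φ (of (b i))) = φ 1

variable {E}

theorem IsRepresentation.norm_le {B : Type w} [NonUnitalCStarAlgebra B] {φ : E.Total → B}
    (h : E.IsRepresentation φ) (x : E.Total) : ‖φ x‖ ≤ ‖x.2‖ := by
  have h1 : star (φ 1) * φ 1 = φ 1 := by
    have := h.star_mul E.one E.one
    rwa [inner_self_eq_norm_sq_to_K, norm_one, RCLike.ofReal_one, one_pow, one_smul] at this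
  have h2 : ‖φ 1‖ ≤ 1 := by
    have := CStarRing.norm_star_mul_self (x := φ 1)
    rw [h1] at this
    nlinarith [norm_nonneg (φ 1)]
  obtain ⟨s, x⟩ := x
  have h3 := congrArg norm (h.star_mul x x)
  rw [CStarRing.norm_star_mul_self, inner_self_eq_norm_sq_to_K, norm_smul, norm_pow,
    RCLike.norm_ofReal, abs_norm] at h3
  change ‖φ (of x)‖ ≤ ‖x‖
  nlinarith [norm_nonneg (φ (of x)), norm_nonneg x, sq_nonneg ‖x‖]

variable (E)

/-- The separable Hilbert space `ℓ²(ℕ)`. -/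
abbrev HilbertSpace : Type := lp (fun _ : ℕ ↦ ℂ) 2

/-- The Cuntz representations of `E` on the Hilbert space `ℓ²(ℕ)` (they may be degenerate). -/
def HilbertCuntzRep : Type (max u v) :=
  {φ : E.Total → (HilbertSpace →L[ℂ] HilbertSpace) // E.IsCuntzRepresentation φ}

/-- The `C*`-algebra of bounded families of operators on `ℓ²(ℕ)`, indexed by the Cuntz
representations of `E` on `ℓ²(ℕ)`. -/
def Ambient : Type (max u v) :=
  lp (fun _ : E.HilbertCuntzRep ↦ HilbertSpace →L[ℂ] HilbertSpace) ∞

noncomputable instance : NonUnitalCStarAlgebra E.Ambient :=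
  inferInstanceAs (NonUnitalCStarAlgebra
    (lp (fun _ : E.HilbertCuntzRep ↦ HilbertSpace →L[ℂ] HilbertSpace) ∞))

variable {E}

/-- The component at `φ`, a `*`-homomorphism. -/
noncomputable def Ambient.eval (φ : E.HilbertCuntzRep) :
    E.Ambient →⋆ₙₐ[ℂ] (HilbertSpace →L[ℂ] HilbertSpace) where
  toFun a := (show lp (fun _ : E.HilbertCuntzRep ↦ HilbertSpace →L[ℂ] HilbertSpace) ∞ from a) φ
  map_smul' _ _ := rfl
  map_zero' := rfl
  map_add' _ _ := rfl
  map_mul' _ _ := rfl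
  map_star' _ := rfl

theorem Ambient.ext {a b : E.Ambient} (h : ∀ φ, eval φ a = eval φ b) : a = b :=
  lp.ext (funext h)

variable (E)

/-- The direct sum of all Cuntz representations of `E` on `ℓ²(ℕ)`. -/
noncomputable def directSum (x : E.Total) : E.Ambient :=
  show lp (fun _ : E.HilbertCuntzRep ↦ HilbertSpace →L[ℂ] HilbertSpace) ∞ from
  ⟨fun φ ↦ φ.1 x, memℓp_infty ⟨‖x.2‖, by
    rintro _ ⟨φ, rfl⟩
    exact φ.2.toIsRepresentation.norm_le x⟩⟩

theorem eval_directSum (φ : E.HilbertCuntzRep) (x : E.Total) :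
    Ambient.eval φ (E.directSum x) = φ.1 x := rfl

/-- The algebra `𝓞_E`: the `C*`-algebra generated by the direct sum of all Cuntz representations
of `E` on `ℓ²(ℕ)`. For countable `P` it is the universal `C*`-algebra for Cuntz representations,
see `isUniversal_cuntzAlgebra`. -/
noncomputable def cuntzAlgebra : NonUnitalStarSubalgebra ℂ E.Ambient :=
  (NonUnitalStarAlgebra.adjoin ℂ (Set.range E.directSum)).topologicalClosure

instance : IsClosed (E.cuntzAlgebra : Set E.Ambient) :=
  NonUnitalStarSubalgebra.isClosed_topologicalClosure _

/-- The canonical Cuntz representation `i_E : E → 𝓞_E`. -/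
noncomputable def iE (x : E.Total) : E.cuntzAlgebra :=
  ⟨E.directSum x, NonUnitalStarSubalgebra.le_topologicalClosure _
    (NonUnitalStarAlgebra.subset_adjoin ℂ _ ⟨x, rfl⟩)⟩

variable {E}

theorem IsCuntzRepresentation.comp {B C : Type*} [NonUnitalCStarAlgebra B]
    [NonUnitalCStarAlgebra C] {φ : E.Total → B} (h : E.IsCuntzRepresentation φ)
    (π : B →⋆ₙₐ[ℂ] C) : E.IsCuntzRepresentation (fun x ↦ π (φ x)) where
  map_mul x y := by rw [h.map_mul, map_mul]
  star_mul x y := by rw [← map_star, ← _root_.map_mul, h.star_mul, map_smul]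
  sum_mul_star t b := by
    rw [← h.sum_mul_star t b, map_sum]
    exact Finset.sum_congr rfl fun i _ ↦ by rw [_root_.map_mul, map_star]

theorem IsCuntzRepresentation.of_comp {B C : Type*} [NonUnitalCStarAlgebra B]
    [NonUnitalCStarAlgebra C] {φ : E.Total → B} (π : B →⋆ₙₐ[ℂ] C) (hπ : Function.Injective π)
    (h : E.IsCuntzRepresentation (fun x ↦ π (φ x))) : E.IsCuntzRepresentation φ where
  map_mul x y := hπ (by rw [h.map_mul, map_mul])
  star_mul x y := hπ (by rw [map_mul, map_star, h.star_mul, map_smul])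
  sum_mul_star t b := hπ (by
    rw [← h.sum_mul_star t b, map_sum]
    exact Finset.sum_congr rfl fun i _ ↦ by rw [_root_.map_mul, map_star])

theorem IsCuntzRepresentation.prod {B C : Type*} [NonUnitalCStarAlgebra B]
    [NonUnitalCStarAlgebra C] {φ : E.Total → B} {ψ : E.Total → C}
    (h : E.IsCuntzRepresentation φ) (h' : E.IsCuntzRepresentation ψ) :
    E.IsCuntzRepresentation (fun x ↦ (φ x, ψ x)) where
  map_mul x y := Prod.ext (h.map_mul x y) (h'.map_mul x y)
  star_mul x y := Prod.ext (h.star_mul x y) (h'.star_mul x y)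
  sum_mul_star t b := Prod.ext
    (by rw [Prod.fst_sum]; exact h.sum_mul_star t b)
    (by rw [Prod.snd_sum]; exact h'.sum_mul_star t b)

theorem IsRepresentation.continuous {B : Type*} [NonUnitalCStarAlgebra B] {φ : E.Total → B}
    (h : E.IsRepresentation φ) (s : P) : Continuous fun x : E.Fiber s ↦ φ (of x) := by
  have h1 : ‖φ 1‖ ≤ 1 := (h.norm_le 1).trans_eq E.norm_one
  refine LipschitzWith.continuous (K := 1) (LipschitzWith.of_dist_le_mul fun x y ↦ ?_)
  rw [dist_eq_norm, dist_eq_norm, NNReal.coe_one, one_mul]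
  have h2 : star (φ (of x) - φ (of y)) * (φ (of x) - φ (of y)) = ⟪x - y, x - y⟫_ℂ • φ 1 := by
    rw [star_sub, sub_mul, mul_sub, mul_sub, h.star_mul, h.star_mul, h.star_mul, h.star_mul,
      inner_sub_left, inner_sub_right, inner_sub_right, sub_smul, sub_smul, sub_smul]
  have h3 := congrArg norm h2
  rw [CStarRing.norm_star_mul_self, inner_self_eq_norm_sq_to_K, norm_smul, norm_pow,
    RCLike.norm_ofReal, abs_norm] at h3
  nlinarith [norm_nonneg (φ (of x) - φ (of y)), norm_nonneg (x - y), sq_nonneg ‖x - y‖]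

theorem IsRepresentation.isSeparable_range [Countable P] {B : Type*} [NonUnitalCStarAlgebra B]
    {φ : E.Total → B} (h : E.IsRepresentation φ) :
    TopologicalSpace.IsSeparable (Set.range φ) := by
  have h1 : Set.range φ = ⋃ s : P, Set.range fun x : E.Fiber s ↦ φ (of x) := by
    ext b
    simp only [Set.mem_range, Set.mem_iUnion]
    exact ⟨fun ⟨x, hx⟩ ↦ ⟨x.1, x.2, hx⟩, fun ⟨s, x, hx⟩ ↦ ⟨of x, hx⟩⟩
  rw [h1]
  refine TopologicalSpace.IsSeparable.iUnion fun s ↦ ?_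
  have : ProperSpace (E.Fiber s) := FiniteDimensional.proper ℂ _
  exact TopologicalSpace.isSeparable_range (h.continuous s)

variable (E)

theorem isCuntzRepresentation_directSum : E.IsCuntzRepresentation E.directSum where
  map_mul x y := Ambient.ext fun φ ↦ by
    rw [map_mul]; exact φ.2.map_mul x y
  star_mul x y := Ambient.ext fun φ ↦ by
    rw [map_mul, map_star, map_smul]; exact φ.2.star_mul x y
  sum_mul_star t b := Ambient.ext fun φ ↦ by
    rw [map_sum]
    simp only [map_mul, map_star]
    exact φ.2.sum_mul_star t b

/-- The universal property of a pair `(O, i)` with respect to `C*`-algebras in the universe `w`: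
`i` is a Cuntz representation of `E` in `O`, every Cuntz representation factors through `i`, and
`O` is generated by `i(E)`. -/
structure IsUniversal {O : Type*} [NonUnitalCStarAlgebra O] (i : E.Total → O) : Prop where
  isCuntzRepresentation : E.IsCuntzRepresentation i
  exists_integratedForm : ∀ (B : Type w) [NonUnitalCStarAlgebra B] (φ : E.Total → B),
    E.IsCuntzRepresentation φ → ∃ π : O →⋆ₙₐ[ℂ] B, ∀ x, π (i x) = φ x
  generates : (NonUnitalStarAlgebra.adjoin ℂ (Set.range i)).topologicalClosure = ⊤

/-- Two `*`-homomorphisms agree on a `C*`-algebra as soon as they agree on generators. -/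
theorem starHom_eq_on_closure {A B : Type*} [NonUnitalCStarAlgebra A] [NonUnitalCStarAlgebra B]
    (f : A →⋆ₙₐ[ℂ] B) (g : A →⋆ₙₐ[ℂ] B) {s : Set A}
    (h : ∀ x ∈ s, f x = g x) {x : A}
    (hx : x ∈ (NonUnitalStarAlgebra.adjoin ℂ s).topologicalClosure) : f x = g x := by
  have h1 : NonUnitalStarAlgebra.adjoin ℂ s ≤ NonUnitalStarAlgHom.equalizer f g :=
    NonUnitalStarAlgebra.adjoin_le h
  have hc : ContinuousLinearMapClass (A →⋆ₙₐ[ℂ] B) ℂ A B :=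
    NonUnitalStarAlgHom.instContinuousLinearMapClassComplex
  have h2 : IsClosed (NonUnitalStarAlgHom.equalizer f g : Set A) :=
    isClosed_eq (map_continuous f) (map_continuous g)
  exact NonUnitalStarSubalgebra.topologicalClosure_minimal _ h1 h2 hx

/-- In the `C*`-subalgebra generated by a set, that set generates. -/
theorem closure_adjoin_preimage {A X : Type*} [NonUnitalCStarAlgebra A] (ψ : X → A)
    (D : NonUnitalStarSubalgebra ℂ A) [hcl : IsClosed (D : Set A)]
    (hD : D = (NonUnitalStarAlgebra.adjoin ℂ (Set.range ψ)).topologicalClosure) (ψ' : X → D)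
    (hψ' : ∀ x, (ψ' x : A) = ψ x) :
    (NonUnitalStarAlgebra.adjoin ℂ (Set.range ψ')).topologicalClosure = ⊤ := by
  let K := (NonUnitalStarAlgebra.adjoin ℂ (Set.range ψ')).topologicalClosure
  let ι : D →⋆ₙₐ[ℂ] A := NonUnitalStarSubalgebraClass.subtype D
  have hK : IsClosed (NonUnitalStarSubalgebra.map ι K : Set A) :=
    (hcl.isClosedEmbedding_subtypeVal.isClosedMap) _
      (NonUnitalStarSubalgebra.isClosed_topologicalClosure _)
  have h1 : D ≤ NonUnitalStarSubalgebra.map ι K := by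
    conv_lhs => rw [hD]
    refine NonUnitalStarSubalgebra.topologicalClosure_minimal _
      (NonUnitalStarAlgebra.adjoin_le ?_) hK
    rintro _ ⟨x, rfl⟩
    exact ⟨ψ' x, NonUnitalStarSubalgebra.le_topologicalClosure _
      (NonUnitalStarAlgebra.subset_adjoin ℂ _ ⟨x, rfl⟩), hψ' x⟩
  refine SetLike.ext fun d ↦ ⟨fun _ ↦ trivial, fun _ ↦ ?_⟩
  obtain ⟨k, hk, hkd⟩ := h1 d.2
  have : k = d := Subtype.ext hkd
  exact this ▸ hk

theorem isCuntzRepresentation_iE : E.IsCuntzRepresentation E.iE :=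
  .of_comp (NonUnitalStarSubalgebraClass.subtype E.cuntzAlgebra) Subtype.val_injective
    E.isCuntzRepresentation_directSum

/-- For countable `P`, the pair `(𝓞_E, i_E)` has the universal property with respect to
`C*`-algebras in every universe. -/
theorem isUniversal_cuntzAlgebra [Countable P] : IsUniversal.{u, v, w} E E.iE where
  isCuntzRepresentation := E.isCuntzRepresentation_iE
  generates := closure_adjoin_preimage E.directSum E.cuntzAlgebra rfl E.iE fun _ ↦ rfl
  exists_integratedForm B _ φ hφ := by
    let ψ : E.Total → E.Ambient × B := fun x ↦ (E.directSum x, φ x)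
    have hψ : E.IsCuntzRepresentation ψ := E.isCuntzRepresentation_directSum.prod hφ
    let D : NonUnitalStarSubalgebra ℂ (E.Ambient × B) :=
      (NonUnitalStarAlgebra.adjoin ℂ (Set.range ψ)).topologicalClosure
    have hDcl : IsClosed (D : Set (E.Ambient × B)) :=
      NonUnitalStarSubalgebra.isClosed_topologicalClosure _
    have : TopologicalSpace.SeparableSpace D :=
      (isSeparable_closure_adjoin hψ.toIsRepresentation.isSeparable_range).separableSpace
    let ψ' : E.Total → D := fun x ↦ ⟨ψ x, NonUnitalStarSubalgebra.le_topologicalClosure _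
      (NonUnitalStarAlgebra.subset_adjoin ℂ _ ⟨x, rfl⟩)⟩
    let ι : D →⋆ₙₐ[ℂ] (E.Ambient × B) := NonUnitalStarSubalgebraClass.subtype D
    have hψ' : E.IsCuntzRepresentation ψ' := .of_comp ι Subtype.val_injective hψ
    have hgen := closure_adjoin_preimage ψ D rfl ψ' fun _ ↦ rfl
    let p : D →⋆ₙₐ[ℂ] E.Ambient := (NonUnitalStarAlgHom.fst ℂ E.Ambient B).comp ι
    let q : D →⋆ₙₐ[ℂ] B := (NonUnitalStarAlgHom.snd ℂ E.Ambient B).comp ι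
    have hp : Function.Injective p := by
      refine (injective_iff_map_eq_zero p).2 fun d hd ↦ ?_
      by_contra hd0
      obtain ⟨ρ, hρ⟩ := exists_representation_ne_zero hd0
      let j : E.HilbertCuntzRep := ⟨fun x ↦ ρ (ψ' x), hψ'.comp ρ⟩
      have h1 : ρ d = (Ambient.eval j).comp p d :=
        starHom_eq_on_closure ρ ((Ambient.eval j).comp p) (s := Set.range ψ')
          (by rintro _ ⟨x, rfl⟩; rfl) (by rw [hgen]; trivial)
      exact hρ (h1.trans (by rw [NonUnitalStarAlgHom.comp_apply, hd, map_zero]))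
    have hrange : E.cuntzAlgebra ≤ NonUnitalStarAlgHom.range p := by
      refine NonUnitalStarSubalgebra.topologicalClosure_minimal _
        (NonUnitalStarAlgebra.adjoin_le ?_) ?_
      · rintro _ ⟨x, rfl⟩
        exact ⟨ψ' x, rfl⟩
      · rw [NonUnitalStarAlgHom.coe_range]
        exact (NonUnitalStarAlgHom.isometry p hp).isClosedEmbedding.isClosed_range
    have hex : ∀ o : E.cuntzAlgebra, ∃ d : D, p d = o := fun o ↦ hrange o.2
    choose r hr using hex
    refine ⟨{ toFun := fun o ↦ q (r o), map_smul' := ?_, map_zero' := ?_, map_add' := ?_,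
              map_mul' := ?_, map_star' := ?_ }, fun x ↦ ?_⟩
    · intro c x
      rw [show r (c • x) = c • r x from hp (by rw [hr, map_smul, hr]; rfl), map_smul]; rfl
    · rw [show r 0 = 0 from hp (by rw [hr, map_zero]; rfl), map_zero]
    · intro x y
      rw [show r (x + y) = r x + r y from hp (by rw [hr, map_add, hr, hr]; rfl), map_add]
    · intro x y
      rw [show r (x * y) = r x * r y from hp (by rw [hr, map_mul, hr, hr]; rfl), map_mul]
    · intro x
      rw [show r (star x) = star (r x) from hp (by rw [hr, map_star, hr]; rfl), map_star]
    · change q (r (E.iE x)) = φ x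
      rw [show r (E.iE x) = ψ' x from hp (by rw [hr]; rfl)]
      rfl

end ProductSystem

universe u v w

/-! Everything reduces to one compression property: for each nonzero `a` some `z` makes `z* a* a z`
invertible. Then every nonzero ideal contains a unit. Moreover a proper isometry, which exists as
soon as some fiber has dimension at least 2, can be transported into the corner of a projection in
any nonzero hereditary subalgebra.

To find `z`, let the infinite torus act on the algebra, multiplying the image `H_s` of the fiber
over `s` by the character attached to the prime factorization of `dim E_s`. The Haar average is a
contraction that does not kill `a* a`; it fixes `H_s H_s*` and, because the dimensions are distinct,
kills `H_s H_t*` for `s ≠ t`. Approximate `a* a` by a finite sum, and let `T` be its average. All of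
`T` lies in one matrix algebra `H_r H_r*`, so compressing by a unit eigenvector in `H_r` turns `T`
into a scalar of modulus `‖T‖`. It remains to make the off-diagonal terms small.

This is the heart (`exists_hsNormSq_lt`, `exists_norm_compression_lt`). Compressions of `b ∈ H_s
H_t*` by isometries from the `H_u` stay in this finite-dimensional space, because `P` is
commutative, so the closure of the orbit of `b` is compact. An element of least Hilbert-Schmidt norm
there must be 0. Indeed the squared norms of all the blocks `e_j* b e_k`, for a basis `e` of `H_u`,
add up to `dim H_u` times that of `b`; if no diagonal block is shorter than `b`, the off-diagonal
blocks vanish. With `u = t`, such a `b ≠ 0` maps a basis of `H_t` to nonzero orthogonal vectors of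
`H_s`; with `u = s`, `b*` does the reverse. So the two dimensions would agree.
`exists_isUnit_star_mul_mul` assembles these pieces. -/

/-- A multiplicative family of Hilbert spaces in a unital `C*`-algebra, each of which has a finite
orthonormal basis whose range projections sum to `1`. -/
structure HilbertSpaceSystem (P : Type v) [CommMonoid P] (A : Type u) [CStarAlgebra A] where
  space : P → Submodule ℂ A
  dim : P → ℕ
  basis : ∀ s, Fin (dim s) → A
  basis_mem : ∀ s i, basis s i ∈ space s
  star_basis_mul_basis : ∀ s i j, star (basis s i) * basis s j = if i = j then 1 else 0
  sum_basis_mul_star : ∀ s, ∑ i, basis s i * star (basis s i) = 1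
  exists_scalar : ∀ {s x y}, x ∈ space s → y ∈ space s → ∃ c : ℂ, star y * x = c • (1 : A)
  mul_mem : ∀ {s t x y}, x ∈ space s → y ∈ space t → x * y ∈ space (s * t)

/-- If the elements `b_j* a_i` are scalars and the range projections of both families sum to `1`,
then the two families implement the same map `c ↦ ∑ a_i* c a_i`. -/
theorem sum_star_mul_mul_eq_of_scalar {A I J : Type*} [CStarAlgebra A] [Fintype I] [Fintype J]
    {a : I → A} {b : J → A} (ha : ∑ i, a i * star (a i) = 1) (hb : ∑ j, b j * star (b j) = 1)
    (hab : ∀ i j, ∃ c : ℂ, star (b j) * a i = c • (1 : A)) (x : A) :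
    ∑ i, star (a i) * x * a i = ∑ j, star (b j) * x * b j := by
  have h1 : ∀ i, star (a i) * x * a i = ∑ j, star (b j) * a i * star (a i) * x * b j := by
    intro i
    calc star (a i) * x * a i = star (a i) * x * ((∑ j, b j * star (b j)) * a i) := by
          rw [hb, one_mul]
      _ = ∑ j, star (b j) * a i * star (a i) * x * b j := by
          rw [Finset.sum_mul, Finset.mul_sum]
          refine Finset.sum_congr rfl fun j _ ↦ ?_
          obtain ⟨c, hc⟩ := hab i j
          rw [mul_assoc (b j), hc]
          simp only [smul_mul_assoc, mul_smul_comm, mul_one, one_mul, mul_assoc]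
  simp_rw [h1]
  rw [Finset.sum_comm]
  refine Finset.sum_congr rfl fun j _ ↦ ?_
  rw [← Finset.sum_mul, ← Finset.sum_mul]
  simp_rw [mul_assoc (star (b j))]
  rw [← Finset.mul_sum, ha, mul_one, mul_assoc]

/-! ### Calculus of the spans `H_s H_t*`. -/

namespace HilbertSpaceSystem

variable {P : Type v} [CommMonoid P] {A : Type u} [CStarAlgebra A] (H : HilbertSpaceSystem P A)

/-- The span of the elements `x y*` with `x ∈ H_s` and `y ∈ H_t`. -/
noncomputable def rankOne (s t : P) : Submodule ℂ A :=
  Submodule.span ℂ {a | ∃ x ∈ H.space s, ∃ y ∈ H.space t, a = x * star y}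

variable {H}

theorem mul_star_mem {s t : P} {x y : A} (hx : x ∈ H.space s) (hy : y ∈ H.space t) :
    x * star y ∈ H.rankOne s t :=
  Submodule.subset_span ⟨x, hx, y, hy, rfl⟩

theorem map_mem_of_mem_rankOne {s t : P} {a : A} (ha : a ∈ H.rankOne s t) (f : A →ₗ[ℂ] A)
    {S : Submodule ℂ A} (h : ∀ x ∈ H.space s, ∀ y ∈ H.space t, f (x * star y) ∈ S) : f a ∈ S := by
  refine (Submodule.span_le (p := S.comap f)).2 ?_ ha
  rintro _ ⟨x, hx, y, hy, rfl⟩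
  exact h x hx y hy

theorem star_mem_rankOne {s t : P} {a : A} (ha : a ∈ H.rankOne s t) :
    star a ∈ H.rankOne t s := by
  refine Submodule.span_induction (p := fun a _ ↦ star a ∈ H.rankOne t s) ?_ ?_ ?_ ?_ ha
  · rintro _ ⟨x, hx, y, hy, rfl⟩
    rw [star_mul, star_star]
    exact mul_star_mem hy hx
  · simp
  · intro a b _ _ h h'
    rw [star_add]
    exact add_mem h h'
  · intro c a _ h
    rw [star_smul]
    exact Submodule.smul_mem _ _ h

theorem eq_sum_basis (s : P) (a : A) :
    a = ∑ i, H.basis s i * (star (H.basis s i) * a) := by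
  simp_rw [← mul_assoc]
  rw [← Finset.sum_mul, H.sum_basis_mul_star, one_mul]

theorem eq_sum_mul_star (s : P) (a : A) :
    a = ∑ i, a * H.basis s i * star (H.basis s i) := by
  simp_rw [mul_assoc]
  rw [← Finset.mul_sum, H.sum_basis_mul_star, mul_one]

/-- Products of basis elements of `H_t` and `H_u` have range projections summing to 1, so `z`
expands in them with scalar coefficients; `y*` then turns each left factor into a scalar. -/
theorem star_mul_mem {t u : P} {y z : A} (hy : y ∈ H.space t) (hz : z ∈ H.space (t * u)) :
    star y * z ∈ H.space u := by
  have h1 : z = ∑ i, ∑ j, H.basis t i * H.basis u j *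
      (star (H.basis t i * H.basis u j) * z) := by
    conv_lhs => rw [eq_sum_basis (H := H) t z]
    refine Finset.sum_congr rfl fun i _ ↦ ?_
    conv_lhs => rw [eq_sum_basis (H := H) u (star (H.basis t i) * z), Finset.mul_sum]
    simp only [star_mul, mul_assoc]
  rw [h1, Finset.mul_sum]
  refine Submodule.sum_mem _ fun i _ ↦ ?_
  rw [Finset.mul_sum]
  refine Submodule.sum_mem _ fun j _ ↦ ?_
  obtain ⟨c, hc⟩ := H.exists_scalar hz (H.mul_mem (H.basis_mem t i) (H.basis_mem u j))
  obtain ⟨d, hd⟩ := H.exists_scalar (H.basis_mem t i) hy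
  rw [hc, mul_smul_comm, mul_one, mul_smul_comm, ← mul_assoc, hd, smul_mul_assoc, one_mul]
  exact Submodule.smul_mem _ _ (Submodule.smul_mem _ _ (H.basis_mem u j))

/-- Insert `1 = ∑ e_i e_i*` on the right. Commutativity of `P` enters here: `x e_i` lies in `H_{st}
= H_{ts}`, so `y*` can remove a factor from its left and leave an element of `H_s`. -/
theorem star_mul_mem_rankOne {s t : P} {x y : A} (hx : x ∈ H.space s) (hy : y ∈ H.space t) :
    star y * x ∈ H.rankOne s t := by
  rw [eq_sum_mul_star (H := H) t (star y * x)]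
  refine Submodule.sum_mem _ fun i _ ↦ mul_star_mem ?_ (H.basis_mem t i)
  rw [mul_assoc]
  refine star_mul_mem hy ?_
  rw [mul_comm]
  exact H.mul_mem hx (H.basis_mem t i)

theorem mul_mem_rankOne {r s t : P} {x a : A} (hx : x ∈ H.space r)
    (ha : a ∈ H.rankOne s t) : x * a ∈ H.rankOne (r * s) t := by
  refine map_mem_of_mem_rankOne ha (LinearMap.mulLeft ℂ x) fun y hy z hz ↦ ?_
  rw [LinearMap.mulLeft_apply, ← mul_assoc]
  exact mul_star_mem (H.mul_mem hx hy) hz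

theorem rankOne_mul_star_mem {r s t : P} {x a : A} (ha : a ∈ H.rankOne s t)
    (hx : x ∈ H.space r) : a * star x ∈ H.rankOne s (r * t) := by
  have h := star_mem_rankOne (mul_mem_rankOne hx (star_mem_rankOne ha))
  rwa [star_mul, star_star] at h

theorem rankOne_mul_rankOne {s t s' t' : P} {a b : A} (ha : a ∈ H.rankOne s t)
    (hb : b ∈ H.rankOne s' t') : a * b ∈ H.rankOne (s * s') (t' * t) := by
  refine map_mem_of_mem_rankOne ha (LinearMap.mulRight ℂ b) fun x hx y hy ↦ ?_
  refine map_mem_of_mem_rankOne hb (LinearMap.mulLeft ℂ (x * star y)) fun z hz w hw ↦ ?_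
  rw [LinearMap.mulLeft_apply, mul_assoc, ← mul_assoc (star y)]
  exact mul_mem_rankOne hx (rankOne_mul_star_mem (star_mul_mem_rankOne hz hy) hw)

theorem rankOne_mul_rankOne_same {s t r : P} {a b : A} (ha : a ∈ H.rankOne s t)
    (hb : b ∈ H.rankOne t r) : a * b ∈ H.rankOne s r := by
  refine map_mem_of_mem_rankOne ha (LinearMap.mulRight ℂ b) fun x hx y hy ↦ ?_
  refine map_mem_of_mem_rankOne hb (LinearMap.mulLeft ℂ (x * star y)) fun z hz w hw ↦ ?_
  obtain ⟨c, hc⟩ := H.exists_scalar hz hy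
  rw [LinearMap.mulLeft_apply, mul_assoc, ← mul_assoc (star y), hc, smul_mul_assoc, one_mul,
    mul_smul_comm]
  exact Submodule.smul_mem _ _ (mul_star_mem hx hw)

/-- For `a = x y*`, the factors `v* x` and `y* z` lie in `H_s H_u*` and `H_u H_t*`, and the inner
`H_u* H_u` is scalar. This keeps the orbits under compression inside a finite-dimensional space. -/
theorem star_mul_mul_mem_rankOne {s t u : P} {a v z : A} (ha : a ∈ H.rankOne s t)
    (hv : v ∈ H.space u) (hz : z ∈ H.space u) : star v * a * z ∈ H.rankOne s t := by
  refine map_mem_of_mem_rankOne ha (LinearMap.mulRight ℂ z ∘ₗ LinearMap.mulLeft ℂ (star v))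
    fun x hx y hy ↦ ?_
  have h := star_mem_rankOne (star_mul_mem_rankOne hy hz)
  rw [star_mul, star_star] at h
  simpa [mul_assoc] using rankOne_mul_rankOne_same (star_mul_mem_rankOne hx hv) h

theorem rankOne_mul_mem {s t : P} {a x : A} (ha : a ∈ H.rankOne s t) (hx : x ∈ H.space t) :
    a * x ∈ H.space s := by
  refine map_mem_of_mem_rankOne ha (LinearMap.mulRight ℂ x) fun y hy z hz ↦ ?_
  obtain ⟨c, hc⟩ := H.exists_scalar hx hz
  rw [LinearMap.mulRight_apply, mul_assoc, hc, mul_smul_comm, mul_one]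
  exact Submodule.smul_mem _ _ hy

/-- Insert `1 = ∑ e_i e_i*` between `x` and `y*`. This moves finitely many diagonal terms into one
common matrix algebra. -/
theorem rankOne_le_rankOne_mul (s t u : P) : H.rankOne s t ≤ H.rankOne (s * u) (t * u) := by
  refine fun a ha ↦ map_mem_of_mem_rankOne ha LinearMap.id fun x hx y hy ↦ ?_
  rw [LinearMap.id_apply, ← mul_one x, ← H.sum_basis_mul_star u, Finset.mul_sum, Finset.sum_mul]
  refine Submodule.sum_mem _ fun i _ ↦ ?_
  rw [← mul_assoc, mul_assoc, ← star_mul]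
  exact mul_star_mem (H.mul_mem hx (H.basis_mem u i)) (H.mul_mem hy (H.basis_mem u i))

theorem space_eq_span (s : P) : H.space s = Submodule.span ℂ (Set.range (H.basis s)) := by
  refine le_antisymm (fun x hx ↦ ?_) (Submodule.span_le.2 ?_)
  · rw [eq_sum_basis (H := H) s x]
    refine Submodule.sum_mem _ fun i _ ↦ ?_
    obtain ⟨c, hc⟩ := H.exists_scalar hx (H.basis_mem s i)
    rw [hc, mul_smul_comm, mul_one]
    exact Submodule.smul_mem _ _ (Submodule.subset_span ⟨i, rfl⟩)
  · rintro _ ⟨i, rfl⟩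
    exact H.basis_mem s i

instance finiteDimensional_space (s : P) : FiniteDimensional ℂ (H.space s) := by
  rw [space_eq_span]
  exact FiniteDimensional.span_of_finite ℂ (Set.finite_range _)

theorem finrank_space_le (s : P) : Module.finrank ℂ (H.space s) ≤ H.dim s := by
  rw [space_eq_span]
  exact (finrank_range_le_card _).trans (by simp)

instance finiteDimensional_rankOne (s t : P) : FiniteDimensional ℂ (H.rankOne s t) := by
  have h : H.rankOne s t = Submodule.span ℂ (Set.range fun p : Fin (H.dim s) × Fin (H.dim t) ↦
      H.basis s p.1 * star (H.basis t p.2)) := by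
    refine le_antisymm (fun a ha ↦ map_mem_of_mem_rankOne ha LinearMap.id fun x hx y hy ↦ ?_)
      (Submodule.span_le.2 ?_)
    · rw [LinearMap.id_apply, eq_sum_basis (H := H) s x, eq_sum_basis (H := H) t y, star_sum,
        Finset.sum_mul_sum]
      refine Submodule.sum_mem _ fun i _ ↦ Submodule.sum_mem _ fun j _ ↦ ?_
      obtain ⟨c, hc⟩ := H.exists_scalar hx (H.basis_mem s i)
      obtain ⟨d, hd⟩ := H.exists_scalar hy (H.basis_mem t j)
      rw [hc, hd, mul_smul_comm, mul_smul_comm, mul_one, mul_one, star_smul, smul_mul_assoc,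
        mul_smul_comm]
      exact Submodule.smul_mem _ _ (Submodule.smul_mem _ _ (Submodule.subset_span ⟨(i, j), rfl⟩))
    · rintro _ ⟨p, rfl⟩
      exact mul_star_mem (H.basis_mem s _) (H.basis_mem t _)
  rw [h]
  exact FiniteDimensional.span_of_finite ℂ (Set.finite_range _)

open scoped ComplexOrder in
-- The scalar `x* x` has modulus `‖x‖ ^ 2` by the `C*`-identity, and it is nonnegative because it is
-- the spectrum of a positive element.
theorem star_mul_self_eq [Nontrivial A] {s : P} {x : A} (hx : x ∈ H.space s) :
    star x * x = ((‖x‖ ^ 2 : ℝ) : ℂ) • (1 : A) := by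
  obtain ⟨c, hc⟩ := H.exists_scalar hx hx
  let := CStarAlgebra.spectralOrder A
  have := CStarAlgebra.spectralOrderedRing A
  have h1 : ‖c‖ = ‖x‖ ^ 2 := by
    have h := congrArg norm hc
    rw [CStarRing.norm_star_mul_self, norm_smul, CStarRing.norm_one, mul_one] at h
    rw [← h, sq]
  have h0 : (0 : A) ≤ algebraMap ℂ A c := by
    rw [Algebra.algebraMap_eq_smul_one, ← hc]; exact star_mul_self_nonneg x
  have h2 : 0 ≤ c := spectrum_nonneg_of_nonneg h0 (by rw [spectrum.scalar_eq]; rfl)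
  rw [hc, ← h1, Complex.eq_coe_norm_of_nonneg h2]
  simp

end HilbertSpaceSystem

/-! ### Hilbert-Schmidt norms and compressions by isometries. -/

namespace HilbertSpaceSystem

variable {P : Type v} [CommMonoid P] {A : Type u} [CStarAlgebra A] (H : HilbertSpaceSystem P A)

/-- The square of the Hilbert-Schmidt norm of an element of `rankOne s t`. -/
noncomputable def hsNormSq (t : P) (a : A) : ℝ := ∑ i, ‖a * H.basis t i‖ ^ 2

variable {H}

theorem continuous_hsNormSq (t : P) : Continuous (H.hsNormSq t) := by
  unfold hsNormSq
  fun_prop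

theorem eq_zero_of_hsNormSq_eq_zero {t : P} {a : A} (h : H.hsNormSq t a = 0) : a = 0 := by
  rw [hsNormSq, Finset.sum_eq_zero_iff_of_nonneg fun _ _ ↦ sq_nonneg _] at h
  rw [eq_sum_mul_star (H := H) t a]
  refine Finset.sum_eq_zero fun i hi ↦ ?_
  rw [norm_eq_zero.1 (pow_eq_zero_iff two_ne_zero |>.1 (h i hi)), zero_mul]

@[simp] theorem hsNormSq_zero (t : P) : H.hsNormSq t 0 = 0 := by simp [hsNormSq]

theorem hsNormSq_nonneg (t : P) (a : A) : 0 ≤ H.hsNormSq t a :=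
  Finset.sum_nonneg fun _ _ ↦ sq_nonneg _

/-- Since `tu = ut`, the products of basis elements in either order are two bases of the same
Hilbert space, and the map `c ↦ ∑ a_i* c a_i` does not depend on the basis. -/
theorem sum_star_basis_mul_mul_basis_comm (t u : P) (a : A) :
    ∑ l, star (H.basis t l) * (∑ k, star (H.basis u k) * a * H.basis u k) * H.basis t l =
      ∑ k, star (H.basis u k) * (∑ l, star (H.basis t l) * a * H.basis t l) * H.basis u k := by
  have h := sum_star_mul_mul_eq_of_scalar
    (a := fun p : Fin (H.dim u) × Fin (H.dim t) ↦ H.basis u p.1 * H.basis t p.2)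
    (b := fun p : Fin (H.dim t) × Fin (H.dim u) ↦ H.basis t p.1 * H.basis u p.2) ?_ ?_ ?_ a
  · rw [Fintype.sum_prod_type_right, Fintype.sum_prod_type_right] at h
    simpa only [star_mul, Finset.mul_sum, Finset.sum_mul, mul_assoc] using h
  · rw [Fintype.sum_prod_type]
    simp_rw [star_mul, mul_assoc]
    simp_rw [← Finset.mul_sum, ← mul_assoc (H.basis t _), ← Finset.sum_mul,
      H.sum_basis_mul_star, one_mul, H.sum_basis_mul_star]
  · rw [Fintype.sum_prod_type]
    simp_rw [star_mul, mul_assoc]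
    simp_rw [← Finset.mul_sum, ← mul_assoc (H.basis u _), ← Finset.sum_mul,
      H.sum_basis_mul_star, one_mul, H.sum_basis_mul_star]
  · intro p q
    refine H.exists_scalar (s := u * t) (H.mul_mem (H.basis_mem u _) (H.basis_mem t _)) ?_
    rw [mul_comm u t]
    exact H.mul_mem (H.basis_mem t _) (H.basis_mem u _)

/-- The squared norm of `b` is the trace `∑ f_l* b* b f_l` over a basis of `H_t`, a scalar. Summing
over `j` collapses `∑ e_j e_j*` to 1, which leaves the trace of `e_k* a* a e_k` for each `k`. -/
theorem sum_hsNormSq_compression [Nontrivial A] {s t : P} {a : A} (ha : a ∈ H.rankOne s t)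
    (u : P) : ∑ k, ∑ j, H.hsNormSq t (star (H.basis u j) * a * H.basis u k) =
      H.dim u * H.hsNormSq t a := by
  have key : ∀ {b : A}, b ∈ H.rankOne s t → ((H.hsNormSq t b : ℝ) : ℂ) • (1 : A) =
      ∑ l, star (H.basis t l) * (star b * b) * H.basis t l := by
    intro b hb
    rw [hsNormSq, Complex.ofReal_sum, Finset.sum_smul]
    refine Finset.sum_congr rfl fun l _ ↦ ?_
    rw [← star_mul_self_eq (rankOne_mul_mem hb (H.basis_mem t l)), star_mul]
    simp only [mul_assoc]
  have h2 : ∀ k, ∑ j, star (star (H.basis u j) * a * H.basis u k) *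
      (star (H.basis u j) * a * H.basis u k) =
        star (H.basis u k) * (star a * a) * H.basis u k := by
    intro k
    calc _ = ∑ j, star (H.basis u k) * star a * (H.basis u j * star (H.basis u j)) *
          (a * H.basis u k) :=
        Finset.sum_congr rfl fun j _ ↦ by simp only [star_mul, star_star, mul_assoc]
      _ = _ := by
        rw [← Finset.sum_mul, ← Finset.mul_sum, H.sum_basis_mul_star, mul_one]
        simp only [mul_assoc]
  have h1 : ((∑ k, ∑ j, H.hsNormSq t (star (H.basis u j) * a * H.basis u k) : ℝ) : ℂ) • (1 : A) =
      ((H.dim u * H.hsNormSq t a : ℝ) : ℂ) • (1 : A) := by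
    simp_rw [Complex.ofReal_sum, Finset.sum_smul]
    simp_rw [key (star_mul_mul_mem_rankOne ha (H.basis_mem u _) (H.basis_mem u _))]
    have h3 : ∀ k, ∑ j, ∑ l, star (H.basis t l) * (star (star (H.basis u j) * a * H.basis u k) *
        (star (H.basis u j) * a * H.basis u k)) * H.basis t l =
        ∑ l, star (H.basis t l) * (star (H.basis u k) * (star a * a) * H.basis u k) *
          H.basis t l := by
      intro k
      rw [Finset.sum_comm]
      refine Finset.sum_congr rfl fun l _ ↦ ?_
      rw [← Finset.sum_mul, ← Finset.mul_sum, h2]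
    simp_rw [h3]
    rw [Finset.sum_comm]
    simp_rw [← Finset.sum_mul, ← Finset.mul_sum]
    -- Once the two bases are exchanged, the inner sum is the scalar trace of `a* a`, so each of the
    -- `dim u` outer terms contributes it once.
    rw [sum_star_basis_mul_mul_basis_comm, ← key ha]
    simp only [mul_smul_comm, smul_mul_assoc, mul_one, H.star_basis_mul_basis, if_true]
    rw [Finset.sum_const, Finset.card_univ, Fintype.card_fin, Complex.ofReal_mul, mul_smul,
      Complex.ofReal_natCast, Nat.cast_smul_eq_nsmul]
  have h3 := smul_left_injective ℂ (one_ne_zero (α := A)) h1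
  exact_mod_cast h3

/-- If no diagonal compression decreases the Hilbert-Schmidt norm, then the off-diagonal
compressions vanish. -/
theorem compression_eq_zero_of_hsNormSq_le [Nontrivial A] {s t u : P} {a : A}
    (ha : a ∈ H.rankOne s t)
    (h : ∀ j, H.hsNormSq t a ≤ H.hsNormSq t (star (H.basis u j) * a * H.basis u j))
    {j k : Fin (H.dim u)} (hjk : j ≠ k) : star (H.basis u j) * a * H.basis u k = 0 := by
  refine eq_zero_of_hsNormSq_eq_zero (H := H) (t := t) (le_antisymm ?_ (hsNormSq_nonneg _ _))
  by_contra! hpos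
  have h1 := sum_hsNormSq_compression ha u
  have h2 : ∑ _k : Fin (H.dim u), H.hsNormSq t a <
      ∑ k, ∑ j, H.hsNormSq t (star (H.basis u j) * a * H.basis u k) := by
    -- Each column sum is at least its diagonal entry, and column `k` contains in addition the
    -- positive entry at `(j, k)`.
    refine Finset.sum_lt_sum (fun i _ ↦ (h i).trans ?_) ⟨k, Finset.mem_univ _, ?_⟩
    · exact Finset.single_le_sum (f := fun j ↦ H.hsNormSq t (star (H.basis u j) * a * H.basis u i))
        (fun _ _ ↦ hsNormSq_nonneg _ _) (Finset.mem_univ i)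
    · refine (h k).trans_lt ?_
      exact Finset.single_lt_sum
        (f := fun j ↦ H.hsNormSq t (star (H.basis u j) * a * H.basis u k)) hjk
        (Finset.mem_univ k) (Finset.mem_univ j) hpos fun _ _ _ ↦ hsNormSq_nonneg _ _
  rw [Finset.sum_const, Finset.card_univ, Fintype.card_fin, nsmul_eq_mul] at h2
  linarith

/-- Nonzero elements with orthogonal ranges in `H_s` are at most `dim H_s` in number. -/
theorem card_le_dim_of_orthogonal {s : P} {n : ℕ} {g : Fin n → A} (hg : ∀ i, g i ∈ H.space s)
    (h0 : ∀ i, g i ≠ 0) (h : ∀ i j, i ≠ j → star (g i) * g j = 0) : n ≤ H.dim s := by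
  have h1 : LinearIndependent ℂ fun i ↦ (⟨g i, hg i⟩ : H.space s) := by
    rw [Fintype.linearIndependent_iff]
    intro c hc i
    have h2 : ∑ j, c j • g j = 0 := by simpa using congrArg Subtype.val hc
    have h3 := congrArg (star (g i) * ·) h2
    simp only [Finset.mul_sum, mul_smul_comm, mul_zero] at h3
    rw [Finset.sum_eq_single i (fun j _ hj ↦ by rw [h i j hj.symm, smul_zero]) (by simp)] at h3
    exact (smul_eq_zero.1 h3).resolve_right
      (mt (CStarRing.star_mul_self_eq_zero_iff _).1 (h0 i))
  simpa using h1.fintype_card_le_finrank.trans (finrank_space_le s)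

/-- Diagonality with respect to the basis `f` of `H_t` means `a f_k = f_k (f_k* a f_k)`. Hence the
elements `a f_k` of `H_s` are nonzero with mutually orthogonal ranges. -/
theorem dim_le_dim_of_compression_eq_zero [Nontrivial A] {s t : P} {a : A}
    (ha : a ∈ H.rankOne s t)
    (hd : ∀ j, star (H.basis t j) * a * H.basis t j ≠ 0)
    (ho : ∀ j k, j ≠ k → star (H.basis t j) * a * H.basis t k = 0) : H.dim t ≤ H.dim s := by
  have h1 : ∀ k, a * H.basis t k = H.basis t k * (star (H.basis t k) * a * H.basis t k) := by
    intro k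
    conv_lhs => rw [eq_sum_basis (H := H) t (a * H.basis t k)]
    rw [Finset.sum_eq_single k (fun j _ hj ↦ by rw [← mul_assoc (star _), ho j k hj, mul_zero])
      (by simp), mul_assoc (star _)]
  refine card_le_dim_of_orthogonal (g := fun k ↦ a * H.basis t k)
    (fun k ↦ rankOne_mul_mem ha (H.basis_mem t k)) (fun k hk ↦ hd k ?_) fun i j hij ↦ ?_
  · rw [mul_assoc, hk, mul_zero]
  · rw [h1 i, h1 j, star_mul, mul_assoc, ← mul_assoc (star (H.basis t i)),
      H.star_basis_mul_basis, if_neg hij, zero_mul, mul_zero]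

/-- Otherwise all compressions of `a` by basis elements are diagonal with nonzero diagonal. The
basis of `H_t` then gives `dim t ≤ dim s`, and the basis of `H_s` applied to `a*` gives the opposite
inequality. -/
theorem exists_hsNormSq_lt [Nontrivial A] {s t : P} (hst : H.dim s ≠ H.dim t) {a : A}
    (ha : a ∈ H.rankOne s t) (ha0 : a ≠ 0) :
    ∃ u, ∃ z ∈ H.space u, star z * z = 1 ∧ H.hsNormSq t (star z * a * z) < H.hsNormSq t a := by
  by_contra! hcon
  have h : ∀ u j, H.hsNormSq t a ≤ H.hsNormSq t (star (H.basis u j) * a * H.basis u j) :=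
    fun u j ↦ hcon u _ (H.basis_mem u j) (by simp [H.star_basis_mul_basis])
  have hd : ∀ u j, star (H.basis u j) * a * H.basis u j ≠ 0 := by
    intro u j h0
    refine ha0 (eq_zero_of_hsNormSq_eq_zero (H := H) (t := t)
      (le_antisymm ((h u j).trans_eq ?_) (hsNormSq_nonneg _ _)))
    rw [h0, hsNormSq_zero]
  have ho : ∀ u j k, j ≠ k → star (H.basis u j) * a * H.basis u k = 0 :=
    fun u j k ↦ compression_eq_zero_of_hsNormSq_le ha (h u)
  refine hst (le_antisymm ?_ (dim_le_dim_of_compression_eq_zero ha (hd t) (ho t)))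
  have hstar : ∀ j k, star (H.basis s j) * star a * H.basis s k =
      star (star (H.basis s k) * a * H.basis s j) := by
    intro j k
    simp [mul_assoc]
  refine dim_le_dim_of_compression_eq_zero (star_mem_rankOne ha) (fun j ↦ ?_) fun j k hjk ↦ ?_
  · rw [hstar, star_ne_zero]
    exact hd s j
  · rw [hstar, ho s k j hjk.symm, star_zero]

variable (H) in
theorem exists_isometry [Nontrivial A] (s : P) : ∃ z ∈ H.space s, star z * z = 1 := by
  have h : Nonempty (Fin (H.dim s)) := by
    by_contra! h
    have h1 := H.sum_basis_mul_star s
    rw [Finset.univ_eq_empty, Finset.sum_empty] at h1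
    exact zero_ne_one h1
  obtain ⟨i⟩ := h
  exact ⟨_, H.basis_mem s i, by simp [H.star_basis_mul_basis]⟩

theorem norm_eq_one_of_isometry [Nontrivial A] {z : A} (hz : star z * z = 1) : ‖z‖ = 1 := by
  have h := CStarRing.norm_star_mul_self (x := z)
  rw [hz, CStarRing.norm_one] at h
  nlinarith [norm_nonneg z]

theorem norm_star_mul_mul_le [Nontrivial A] {z : A} (hz : star z * z = 1) (a : A) :
    ‖star z * a * z‖ ≤ ‖a‖ := by
  refine (norm_mul_le _ _).trans ?_
  rw [norm_eq_one_of_isometry hz, mul_one]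
  refine (norm_mul_le _ _).trans ?_
  rw [norm_star, norm_eq_one_of_isometry hz, one_mul]

/-- Compressions of an element of `rankOne s t` by isometries become arbitrarily small, if `H_s`
and `H_t` have different dimensions. -/
theorem exists_norm_compression_lt [Nontrivial A] {s t : P} (hst : H.dim s ≠ H.dim t) {a : A}
    (ha : a ∈ H.rankOne s t) {ε : ℝ} (hε : 0 < ε) :
    ∃ u, ∃ z ∈ H.space u, star z * z = 1 ∧ ‖star z * a * z‖ < ε := by
  -- The orbit of `a` lies in a ball of the finite-dimensional space `rankOne s t`, so its closure
  -- is compact and `hsNormSq` attains a minimum there.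
  let O : Set A := {b | ∃ u, ∃ z ∈ H.space u, star z * z = 1 ∧ b = star z * a * z}
  let K : Set A := Subtype.val '' (Metric.closedBall (0 : H.rankOne s t) ‖a‖)
  have : ProperSpace (H.rankOne s t) := FiniteDimensional.proper ℂ _
  have hK : IsCompact K := (isCompact_closedBall _ _).image continuous_subtype_val
  have hOK : closure O ⊆ K := by
    refine closure_minimal ?_ hK.isClosed
    rintro _ ⟨u, z, hz, hz1, rfl⟩
    refine ⟨⟨_, star_mul_mul_mem_rankOne ha hz hz⟩, ?_, rfl⟩
    rw [mem_closedBall_zero_iff]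
    exact norm_star_mul_mul_le hz1 a
  have hO : IsCompact (closure O) := hK.of_isClosed_subset isClosed_closure hOK
  have hne : (closure O).Nonempty := by
    obtain ⟨z, hz, hz1⟩ := H.exists_isometry s
    exact ⟨_, subset_closure ⟨s, z, hz, hz1, rfl⟩⟩
  obtain ⟨b, hb, hmin⟩ := hO.exists_isMinOn hne (continuous_hsNormSq (H := H) t).continuousOn
  have hb0 : b = 0 := by
    by_contra hb0
    obtain ⟨⟨b', hb'⟩, -, rfl⟩ := hOK hb
    obtain ⟨u, z, hz, hz1, hlt⟩ := exists_hsNormSq_lt hst hb' hb0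
    -- Compressing by `y` and then by `z` is compressing by `y z`. So the closure of the orbit is
    -- stable under compression by `z`, and a nonzero minimizer could be shortened within it.
    refine absurd (hmin (a := star z * b' * z) ?_) (not_le.2 hlt)
    refine map_mem_closure (f := fun b ↦ star z * b * z) (by fun_prop) hb ?_
    rintro _ ⟨v, y, hy, hy1, rfl⟩
    refine ⟨v * u, y * z, H.mul_mem hy hz, ?_, ?_⟩
    · rw [star_mul, mul_assoc, ← mul_assoc (star y), hy1, one_mul, hz1]
    · simp only [star_mul, mul_assoc]
  obtain ⟨c, ⟨u, z, hz, hz1, rfl⟩, hc⟩ := Metric.mem_closure_iff.1 (hb0 ▸ hb) ε hε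
  exact ⟨u, z, hz, hz1, by simpa using hc⟩

/-- Finitely many elements can be compressed simultaneously. -/
theorem exists_norm_compression_lt_of_finset [Nontrivial A] {ι : Type*} (F : Finset ι)
    {s t : ι → P} (hst : ∀ i ∈ F, H.dim (s i) ≠ H.dim (t i)) {a : ι → A}
    (ha : ∀ i ∈ F, a i ∈ H.rankOne (s i) (t i)) {ε : ℝ} (hε : 0 < ε) :
    ∃ u, ∃ z ∈ H.space u, star z * z = 1 ∧ ∀ i ∈ F, ‖star z * a i * z‖ < ε := by
  classical
  induction F using Finset.induction_on with
  | empty =>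
    obtain ⟨z, hz, hz1⟩ := H.exists_isometry 1
    exact ⟨1, z, hz, hz1, by simp⟩
  | insert i F hi ih =>
    obtain ⟨u, z, hz, hz1, h⟩ := ih (fun j hj ↦ hst j (Finset.mem_insert_of_mem hj))
      fun j hj ↦ ha j (Finset.mem_insert_of_mem hj)
    -- The compression of the new element by `z` is still in its own `rankOne` space, and the
    -- further compression by `y` does not increase the norms already made small.
    obtain ⟨v, y, hy, hy1, h'⟩ := exists_norm_compression_lt
      (hst i (Finset.mem_insert_self _ _))
      (star_mul_mul_mem_rankOne (ha i (Finset.mem_insert_self _ _)) hz hz) hε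
    have hcomp : ∀ b, star (z * y) * b * (z * y) = star y * (star z * b * z) * y := by
      intro b
      simp only [star_mul, mul_assoc]
    refine ⟨u * v, z * y, H.mul_mem hz hy, ?_, fun j hj ↦ ?_⟩
    · rw [← mul_one (star (z * y)), hcomp, mul_one, hz1, mul_one, hy1]
    · rw [hcomp]
      rcases Finset.mem_insert.1 hj with rfl | hj
      · exact h'
      · exact (norm_star_mul_mul_le hy1 _).trans_lt (h j hj)

end HilbertSpaceSystem

/-! ### The matrix algebras `H_r H_r*` and the dense `*`-subalgebra. -/

namespace HilbertSpaceSystem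

variable {P : Type v} [CommMonoid P] {A : Type u} [CStarAlgebra A] {H : HilbertSpaceSystem P A}

theorem one_mem_rankOne (s : P) : 1 ∈ H.rankOne s s := by
  rw [← H.sum_basis_mul_star s]
  exact Submodule.sum_mem _ fun i _ ↦ mul_star_mem (H.basis_mem s i) (H.basis_mem s i)

/-- Points of the spectrum of an element of `rankOne r r` are eigenvalues. -/
theorem exists_eigenvector [Nontrivial A] {r : P} {a : A} (ha : a ∈ H.rankOne r r) {c : ℂ}
    (hc : c ∈ spectrum ℂ a) : ∃ z ∈ H.space r, star z * z = 1 ∧ a * z = c • z := by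
  by_contra! hcon
  let d : A := algebraMap ℂ A c - a
  have hd : d ∈ H.rankOne r r := by
    refine sub_mem ?_ ha
    rw [Algebra.algebraMap_eq_smul_one]
    exact Submodule.smul_mem _ _ (one_mem_rankOne r)
  have hinj : ∀ x ∈ H.space r, d * x = 0 → x = 0 := by
    intro x hx h
    by_contra hx0
    have hn : ‖x‖ ≠ 0 := norm_ne_zero_iff.2 hx0
    refine hcon (((‖x‖⁻¹ : ℝ) : ℂ) • x) (Submodule.smul_mem _ _ hx) ?_ ?_
    · rw [star_smul, smul_mul_smul_comm, star_mul_self_eq hx, smul_smul, Complex.star_def,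
        Complex.conj_ofReal, ← Complex.ofReal_mul, ← Complex.ofReal_mul]
      rw [show ‖x‖⁻¹ * ‖x‖⁻¹ * ‖x‖ ^ 2 = 1 by field_simp, Complex.ofReal_one, one_smul]
    · rw [mul_smul_comm, smul_comm c]
      congr 1
      rw [sub_mul, sub_eq_zero, Algebra.algebraMap_eq_smul_one, smul_mul_assoc, one_mul] at h
      exact h.symm
  -- Without an eigenvector for `c`, `d = c - a` is injective on the finite-dimensional `H_r`, hence
  -- onto; preimages of the basis assemble into a right inverse `R` of `d`.
  let L : H.space r →ₗ[ℂ] H.space r :=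
    (LinearMap.mulLeft ℂ d).restrict fun x hx ↦ rankOne_mul_mem hd hx
  have hL : Function.Injective L := by
    refine (injective_iff_map_eq_zero L).2 fun x hx ↦ Subtype.ext (hinj x x.2 ?_)
    exact congrArg Subtype.val hx
  have hsurj : ∀ i, ∃ x ∈ H.space r, d * x = H.basis r i := fun i ↦ by
    obtain ⟨x, hx⟩ := (LinearMap.injective_iff_surjective.1 hL) ⟨_, H.basis_mem r i⟩
    exact ⟨x, x.2, congrArg Subtype.val hx⟩
  choose g hg hdg using hsurj
  let R : A := ∑ i, g i * star (H.basis r i)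
  have hR : R ∈ H.rankOne r r :=
    Submodule.sum_mem _ fun i _ ↦ mul_star_mem (hg i) (H.basis_mem r i)
  have h1 : d * R = 1 := by
    rw [← H.sum_basis_mul_star r, Finset.mul_sum]
    exact Finset.sum_congr rfl fun i _ ↦ by rw [← mul_assoc, hdg]
  -- Since `d R = 1`, `d` kills `R d - 1` from the left. An element of `rankOne r r` is determined
  -- by its action on `H_r`, where `d` is injective, so `R` is also a left inverse.
  have hS : R * d - 1 ∈ H.rankOne r r :=
    sub_mem (rankOne_mul_rankOne_same hR hd) (one_mem_rankOne r)
  have h2 : R * d - 1 = 0 := by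
    rw [eq_sum_mul_star (H := H) r (R * d - 1)]
    refine Finset.sum_eq_zero fun i _ ↦ ?_
    rw [hinj _ (rankOne_mul_mem hS (H.basis_mem r i)) ?_, zero_mul]
    rw [← mul_assoc, mul_sub, ← mul_assoc, h1]
    simp
  exact hc ⟨⟨d, R, h1, sub_eq_zero.1 h2⟩, rfl⟩

variable (H) in
/-- The `*`-algebra generated by a system of Hilbert spaces. -/
noncomputable def algebraicSpan : Submodule ℂ A := ⨆ p : P × P, H.rankOne p.1 p.2

theorem rankOne_le_algebraicSpan (s t : P) : H.rankOne s t ≤ H.algebraicSpan :=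
  le_iSup (fun p : P × P ↦ H.rankOne p.1 p.2) (s, t)

theorem star_mem_algebraicSpan {a : A} (ha : a ∈ H.algebraicSpan) : star a ∈ H.algebraicSpan := by
  refine Submodule.iSup_induction _ (motive := fun a ↦ star a ∈ H.algebraicSpan) ha
    (fun p a h ↦ rankOne_le_algebraicSpan _ _ (star_mem_rankOne h)) (by simp) fun a b h h' ↦ ?_
  rw [star_add]
  exact add_mem h h'

theorem mul_mem_algebraicSpan {a b : A} (ha : a ∈ H.algebraicSpan) (hb : b ∈ H.algebraicSpan) :
    a * b ∈ H.algebraicSpan := by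
  refine Submodule.iSup_induction _ (motive := fun a ↦ a * b ∈ H.algebraicSpan) ha ?_ (by simp)
    fun a a' h h' ↦ ?_
  · intro p a ha
    refine Submodule.iSup_induction _ (motive := fun b ↦ a * b ∈ H.algebraicSpan) hb ?_ (by simp)
      fun b b' h h' ↦ ?_
    · exact fun q b hb ↦ rankOne_le_algebraicSpan _ _ (rankOne_mul_rankOne ha hb)
    · rw [mul_add]
      exact add_mem h h'
  · rw [add_mul]
    exact add_mem h h'

theorem mem_algebraicSpan {s : P} {x : A} (hx : x ∈ H.space s) : x ∈ H.algebraicSpan := by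
  rw [eq_sum_mul_star (H := H) 1 x]
  refine Submodule.sum_mem _ fun i _ ↦ rankOne_le_algebraicSpan (s * 1) 1 ?_
  exact mul_star_mem (H.mul_mem hx (H.basis_mem 1 i)) (H.basis_mem 1 i)

theorem dense_algebraicSpan {S : Set A} (hS : ∀ x ∈ S, ∃ s, x ∈ H.space s)
    (h : (NonUnitalStarAlgebra.adjoin ℂ S).topologicalClosure = ⊤) :
    Dense (H.algebraicSpan : Set A) := by
  intro a
  have h1 : a ∈ (NonUnitalStarAlgebra.adjoin ℂ S).topologicalClosure := h ▸ trivial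
  refine closure_mono ?_ h1
  intro b hb
  induction hb using NonUnitalStarAlgebra.adjoin_induction with
  | mem x hx => exact mem_algebraicSpan (hS x hx).choose_spec
  | add x y _ _ hx hy => exact add_mem hx hy
  | zero => exact zero_mem _
  | mul x y _ _ hx hy => exact mul_mem_algebraicSpan hx hy
  | smul c x _ hx => exact Submodule.smul_mem _ c hx
  | star x _ hx => exact star_mem_algebraicSpan hx

/-! ### Averaging over a compact group. -/

section Expectation

open MeasureTheory

variable {K : Type*} [TopologicalSpace K] [CompactSpace K] [MeasurableSpace K] [BorelSpace K]
  (δ : A →⋆ₙₐ[ℂ] C(K, A)) (μ : Measure K)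

/-- The average of a coaction by functions on a compact group. -/
noncomputable def expectation (a : A) : A := ∫ χ, δ a χ ∂μ

variable [IsProbabilityMeasure μ]

theorem integrable_coaction (a : A) : Integrable (fun χ ↦ δ a χ) μ :=
  (δ a).continuous.integrable_of_hasCompactSupport (HasCompactSupport.of_compactSpace _)

theorem expectation_sub (a b : A) :
    expectation δ μ (a - b) = expectation δ μ a - expectation δ μ b := by
  unfold expectation
  rw [← integral_sub (integrable_coaction δ μ a) (integrable_coaction δ μ b), map_sub]
  rfl

theorem expectation_sum {ι : Type*} (F : Finset ι) (a : ι → A) :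
    expectation δ μ (∑ i ∈ F, a i) = ∑ i ∈ F, expectation δ μ (a i) := by
  unfold expectation
  rw [← integral_finsetSum F fun i _ ↦ integrable_coaction δ μ (a i), map_sum]
  simp

omit [BorelSpace K] in
theorem norm_expectation_le (a : A) : ‖expectation δ μ a‖ ≤ ‖a‖ := by
  refine (norm_integral_le_of_norm_le_const (C := ‖a‖) (.of_forall fun χ ↦ ?_)).trans_eq (by simp)
  exact ((δ a).norm_coe_le_norm χ).trans (NonUnitalStarAlgHom.norm_apply_le δ a)

theorem star_expectation (a : A) : star (expectation δ μ a) = expectation δ μ (star a) := by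
  unfold expectation
  have h := (starL' ℝ (A := A)).toContinuousLinearMap.integral_comp_comm
    (integrable_coaction δ μ a)
  rw [map_star]
  exact h.symm

open scoped ComplexOrder in
-- A positive functional that is nonzero on `a* a` turns the orbit of `a* a` into a continuous
-- nonnegative function that is positive at the identity; its integral is positive because `μ`
-- charges open sets.
theorem expectation_star_mul_self_ne_zero [One K] (hδ : ∀ a, δ a 1 = a) [μ.IsOpenPosMeasure]
    {a : A} (ha : a ≠ 0) : expectation δ μ (star a * a) ≠ 0 := by
  let := CStarAlgebra.spectralOrder A
  have := CStarAlgebra.spectralOrderedRing A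
  obtain ⟨f, hf⟩ := exists_positiveLinearMap_ne_zero ha
  let L : A →L[ℂ] ℂ := ⟨f.toLinearMap, map_continuous f⟩
  have hnn : ∀ χ, 0 ≤ L (δ (star a * a) χ) := fun χ ↦ by
    rw [map_mul, map_star]
    exact map_nonneg f (star_mul_self_nonneg (δ a χ))
  have h1 : ∫ χ, L (δ (star a * a) χ) ∂μ = L (expectation δ μ (star a * a)) :=
    L.integral_comp_comm (integrable_coaction δ μ _)
  intro h0
  rw [h0, map_zero] at h1
  have hcont : Continuous fun χ ↦ (L (δ (star a * a) χ)).re := by fun_prop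
  have h2 := hcont.integral_pos_of_hasCompactSupport_nonneg_nonzero (μ := μ) (x := 1)
    (HasCompactSupport.of_compactSpace _) (fun χ ↦ (Complex.nonneg_iff.1 (hnn χ)).1) ?_
  · have h4 := Complex.reCLM.integral_comp_comm (L.integrable_comp
      (integrable_coaction δ μ (star a * a)))
    rw [h1, map_zero] at h4
    exact h2.ne' h4
  · intro h3
    refine hf ?_
    have h5 := Complex.nonneg_iff.1 (hnn 1)
    rw [hδ] at h3 h5
    exact Complex.ext h3 h5.2.symm

end Expectation

/-! ### The gauge action and compression to an invertible element. -/

section Gauge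

open MeasureTheory

variable {K : Type*} [TopologicalSpace K] [CompactSpace K] [MeasurableSpace K] [BorelSpace K]
  [Group K] [IsTopologicalGroup K] {δ : A →⋆ₙₐ[ℂ] C(K, A)} {c : P → K →* Circle}

omit [CompactSpace K] [MeasurableSpace K] [BorelSpace K] [IsTopologicalGroup K] in
theorem coaction_apply_of_mem_rankOne
    (hδ : ∀ {s x}, x ∈ H.space s → ∀ χ, δ x χ = (c s χ : ℂ) • x) {s t : P} {a : A}
    (ha : a ∈ H.rankOne s t) (χ : K) : δ a χ = ((c s χ / c t χ : Circle) : ℂ) • a := by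
  let f : A →ₗ[ℂ] A :=
    { toFun := fun a ↦ δ a χ - ((c s χ / c t χ : Circle) : ℂ) • a
      map_add' := fun a b ↦ by
        rw [map_add, ContinuousMap.add_apply, smul_add]; abel
      map_smul' := fun z a ↦ by
        rw [map_smul, ContinuousMap.smul_apply, smul_comm, RingHom.id_apply, smul_sub] }
  have h : f a ∈ (⊥ : Submodule ℂ A) := by
    refine map_mem_of_mem_rankOne ha f fun x hx y hy ↦ ?_
    change δ (x * star y) χ - _ = 0
    rw [map_mul, map_star, ContinuousMap.mul_apply, ContinuousMap.star_apply, hδ hx, hδ hy,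
      star_smul, smul_mul_smul_comm, div_eq_mul_inv, Circle.coe_mul, Circle.coe_inv_eq_conj,
      Complex.star_def, sub_self]
  exact sub_eq_zero.1 h

variable (μ : Measure K) [IsProbabilityMeasure μ]

omit [CompactSpace K] [BorelSpace K] [IsTopologicalGroup K] in
theorem expectation_eq_self
    (hδ : ∀ {s x}, x ∈ H.space s → ∀ χ, δ x χ = (c s χ : ℂ) • x) {s : P} {a : A}
    (ha : a ∈ H.rankOne s s) : expectation δ μ a = a := by
  unfold expectation
  simp_rw [coaction_apply_of_mem_rankOne hδ ha, div_self', Circle.coe_one, one_smul]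
  simp

omit [CompactSpace K] [IsProbabilityMeasure μ] in
-- Translating by a point `χ` where the characters differ multiplies the average by `c s χ / c t χ ≠
-- 1`, while invariance of `μ` leaves it unchanged.
theorem expectation_eq_zero [μ.IsMulLeftInvariant]
    (hδ : ∀ {s x}, x ∈ H.space s → ∀ χ, δ x χ = (c s χ : ℂ) • x) {s t : P} (hst : c s ≠ c t)
    {a : A} (ha : a ∈ H.rankOne s t) : expectation δ μ a = 0 := by
  obtain ⟨χ, hχ⟩ : ∃ χ, c s χ ≠ c t χ := by
    by_contra! h
    exact hst (MonoidHom.ext h)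
  have h1 := integral_mul_left_eq_self (μ := μ) (fun χ ↦ δ a χ) χ
  have h2 : ∀ ψ, δ a (χ * ψ) = ((c s χ / c t χ : Circle) : ℂ) • δ a ψ := by
    intro ψ
    rw [coaction_apply_of_mem_rankOne hδ ha, coaction_apply_of_mem_rankOne hδ ha, smul_smul,
      ← Circle.coe_mul, map_mul, map_mul, mul_div_mul_comm]
  simp_rw [h2] at h1
  rw [integral_smul] at h1
  have h3 : (((c s χ / c t χ : Circle) : ℂ) - 1) • expectation δ μ a = 0 := by
    rw [sub_smul, one_smul, sub_eq_zero]
    exact h1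
  refine (smul_eq_zero.1 h3).resolve_left fun h4 ↦ hχ ?_
  rw [sub_eq_zero, Circle.coe_eq_one, div_eq_one] at h4
  exact h4

theorem isUnit_of_norm_sub_smul_one_lt {a : A} {z : ℂ} (h : ‖a - z • 1‖ < ‖z‖) :
    IsUnit a := by
  have hz : z ≠ 0 := by
    rintro rfl
    exact (norm_nonneg _).not_gt (by simpa using h)
  have h1 : ‖1 - z⁻¹ • a‖ < 1 := by
    have h2 : 1 - z⁻¹ • a = -(z⁻¹ • (a - z • 1)) := by
      rw [smul_sub, inv_smul_smul₀ hz]; abel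
    rw [h2, norm_neg, norm_smul, norm_inv]
    rw [inv_mul_lt_one₀ (norm_pos_iff.2 hz)]
    exact h
  have h2 := isUnit_one_sub_of_norm_lt_one h1
  rw [sub_sub_cancel] at h2
  have h3 := (IsUnit.mk0 z hz).map (algebraMap ℂ A) |>.mul h2
  rwa [← Algebra.smul_def, smul_inv_smul₀ hz] at h3

/-- In an algebra with a gauge action whose characters separate dimensions, every nonzero positive
element compresses to an invertible one. -/
theorem exists_isUnit_star_mul_mul [Nontrivial A] [μ.IsMulLeftInvariant] [μ.IsOpenPosMeasure]
    (hδ : ∀ {s x}, x ∈ H.space s → ∀ χ, δ x χ = (c s χ : ℂ) • x) (hδ1 : ∀ a, δ a 1 = a)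
    (hc : ∀ s t, s ≠ t → c s ≠ c t) (hdim : Function.Injective H.dim)
    (hdense : Dense (H.algebraicSpan : Set A)) {a : A} (ha : a ≠ 0) :
    ∃ z, IsUnit (star z * (star a * a) * z) := by
  classical
  set η := ‖expectation δ μ (star a * a)‖ with hη
  have hη0 : 0 < η := norm_pos_iff.2 (expectation_star_mul_self_ne_zero δ μ hδ1 ha)
  -- Approximating `a` rather than `a* a` keeps the approximant of the form `a₀* a₀`, so that its
  -- average is self-adjoint.
  obtain ⟨a₀, ha₀, hclose⟩ : ∃ a₀ ∈ H.algebraicSpan, ‖star a * a - star a₀ * a₀‖ < η / 4 := by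
    have hcont : Continuous fun b : A ↦ ‖star a * a - star b * b‖ := by fun_prop
    obtain ⟨b, hb, hb'⟩ := hdense.exists_mem_open
      (isOpen_Iio.preimage hcont : IsOpen {b | ‖star a * a - star b * b‖ < η / 4})
      ⟨a, by simpa using hη0⟩
    exact ⟨b, hb, hb'⟩
  set p₀ := star a₀ * a₀ with hp₀
  obtain ⟨g, hg, hsum⟩ := (Submodule.mem_iSup_iff_exists_finsupp _ _).1
    (mul_mem_algebraicSpan (star_mem_algebraicSpan ha₀) ha₀)
  rw [← hp₀, Finsupp.sum] at hsum
  set T := expectation δ μ p₀ with hT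
  let D := g.support.filter fun i ↦ i.1 = i.2
  let F := g.support.filter fun i ↦ ¬ i.1 = i.2
  have hTD : T = ∑ i ∈ D, g i := by
    rw [hT, ← hsum, expectation_sum, Finset.sum_filter]
    refine Finset.sum_congr rfl fun i _ ↦ ?_
    split_ifs with hi
    · exact expectation_eq_self μ hδ (hi ▸ hg i : g i ∈ H.rankOne i.1 i.1)
    · exact expectation_eq_zero μ hδ (hc _ _ hi) (hg i)
  have hsplit : p₀ = T + ∑ i ∈ F, g i := by
    rw [hTD, ← hsum]
    exact (Finset.sum_filter_add_sum_filter_not _ _ _).symm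
  -- Every index in `D` divides this product, so all diagonal terms lie in the single matrix algebra
  -- `rankOne r r`.
  let r : P := ∏ i ∈ D, i.1
  have hTr : T ∈ H.rankOne r r := by
    rw [hTD]
    refine Submodule.sum_mem _ fun i hi ↦ ?_
    obtain ⟨q, hq⟩ := Finset.dvd_prod_of_mem (fun i : P × P ↦ i.1) hi
    have h1 : g i ∈ H.rankOne i.1 i.1 := by
      have h2 := hg i
      rwa [← (Finset.mem_filter.1 hi).2] at h2
    have h3 := rankOne_le_rankOne_mul i.1 i.1 q h1
    rwa [← hq] at h3
  have hTnorm : η - η / 4 < ‖T‖ := by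
    have h1 := (norm_expectation_le δ μ (star a * a - p₀)).trans_lt hclose
    rw [expectation_sub] at h1
    have h2 := norm_sub_norm_le (expectation δ μ (star a * a)) (expectation δ μ p₀)
    linarith
  have hTsa : IsSelfAdjoint T := by
    rw [IsSelfAdjoint, hT, star_expectation, hp₀, star_mul, star_star]
  -- For self-adjoint `T` the spectral radius is the norm, so some spectral value has modulus `‖T‖`;
  -- in `rankOne r r` it is an eigenvalue.
  obtain ⟨k, hk, hknorm⟩ := spectrum.exists_nnnorm_eq_spectralRadius T
  rw [hTsa.spectralRadius_eq_nnnorm] at hknorm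
  have hk' : ‖k‖ = ‖T‖ := by
    have := ENNReal.coe_injective hknorm
    exact congrArg NNReal.toReal this
  obtain ⟨z₀, hz₀, hz₀1, hTz⟩ := exists_eigenvector hTr hk
  -- Compression by `z₀` leaves each off-diagonal term in its own `rankOne` space. The choice of `ε`
  -- bounds the total by `η / 4`; the `+ 1` covers an empty `F`.
  obtain ⟨u, z₁, hz₁, hz₁1, hsmall⟩ := exists_norm_compression_lt_of_finset (H := H) F
    (s := Prod.fst) (t := Prod.snd) (a := fun i ↦ star z₀ * g i * z₀)
    (ε := η / 4 / (F.card + 1))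
    (fun i hi h ↦ (Finset.mem_filter.1 hi).2 (hdim h))
    (fun i _ ↦ star_mul_mul_mem_rankOne (hg i) hz₀ hz₀) (by positivity)
  have hzz : star (z₀ * z₁) * (z₀ * z₁) = 1 := by
    rw [star_mul, mul_assoc, ← mul_assoc (star z₀), hz₀1, one_mul, hz₁1]
  refine ⟨z₀ * z₁, isUnit_of_norm_sub_smul_one_lt (z := k) ?_⟩
  have hF : star (z₀ * z₁) * (∑ i ∈ F, g i) * (z₀ * z₁) =
      ∑ i ∈ F, star z₁ * (star z₀ * g i * z₀) * z₁ := by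
    rw [Finset.mul_sum, Finset.sum_mul]
    exact Finset.sum_congr rfl fun i _ ↦ by simp only [star_mul, mul_assoc]
  have hTk : star (z₀ * z₁) * T * (z₀ * z₁) = k • 1 := by
    rw [mul_assoc, ← mul_assoc T, hTz, smul_mul_assoc, mul_smul_comm, hzz]
  have hdecomp : star (z₀ * z₁) * (star a * a) * (z₀ * z₁) - k • 1 =
      star (z₀ * z₁) * (star a * a - p₀) * (z₀ * z₁) +
        ∑ i ∈ F, star z₁ * (star z₀ * g i * z₀) * z₁ := by
    rw [← hF, ← hTk, hsplit, mul_sub, mul_add, sub_mul, add_mul]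
    abel
  have hb1 : ‖∑ i ∈ F, star z₁ * (star z₀ * g i * z₀) * z₁‖ ≤ η / 4 := by
    refine (norm_sum_le_of_le F fun i hi ↦ (hsmall i hi).le).trans ?_
    rw [Finset.sum_const, nsmul_eq_mul, mul_div_assoc', div_le_iff₀ (by positivity)]
    nlinarith
  -- The approximation error and the off-diagonal part together stay below `η / 2`, whereas `‖k‖ =
  -- ‖T‖ > 3 η / 4`.
  rw [hdecomp, hk']
  have hb2 := (norm_star_mul_mul_le hzz (star a * a - p₀)).trans_lt hclose
  have hb3 := norm_add_le (star (z₀ * z₁) * (star a * a - p₀) * (z₀ * z₁))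
    (∑ i ∈ F, star z₁ * (star z₀ * g i * z₀) * z₁)
  linarith

end Gauge

end HilbertSpaceSystem

/-! ### Simplicity and pure infiniteness from compression to units. -/

/-- An algebra in which nonzero positive elements compress to invertible ones is simple. -/
theorem isSimpleCStarAlgebra_of_exists_isUnit {A : Type*} [CStarAlgebra A] [Nontrivial A]
    (h : ∀ a : A, a ≠ 0 → ∃ z, IsUnit (star z * (star a * a) * z)) : IsSimpleCStarAlgebra A := by
  refine ⟨inferInstance, fun I _ ↦ or_iff_not_imp_left.2 fun hI ↦ ?_⟩
  obtain ⟨a, ha, ha0⟩ : ∃ a ∈ I, a ≠ 0 := by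
    by_contra! hcon
    refine hI (le_bot_iff.1 fun a ha ↦ ?_)
    rw [hcon a ha]
    exact zero_mem _
  obtain ⟨z, hz⟩ := h a ha0
  have h1 : star z * (star a * a) * z ∈ I :=
    I.mul_mem_right _ _ (I.mul_mem_left _ _ (I.mul_mem_left _ _ ha))
  obtain ⟨b, hb⟩ := hz.exists_right_inv
  refine top_le_iff.1 fun x _ ↦ ?_
  have h2 := I.mul_mem_right _ x (I.mul_mem_right _ b h1)
  rwa [hb, one_mul] at h2

/-- Take `g` to be the inverse of the square root of `b* b`; then `b g` is an isometry. -/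
theorem exists_star_eq_mul_mul_eq_one {A : Type*} [CStarAlgebra A] {b : A}
    (hb : IsUnit (star b * b)) : ∃ g : A, star g = g ∧ g * (star b * b) * g = 1 := by
  let := CStarAlgebra.spectralOrder A
  have := CStarAlgebra.spectralOrderedRing A
  have h0 : 0 ≤ star b * b := star_mul_self_nonneg b
  have h1 : CFC.sqrt (star b * b) * CFC.sqrt (star b * b) = star b * b := CFC.sqrt_mul_sqrt_self _
  have h2 : IsUnit (CFC.sqrt (star b * b)) := by
    rw [← h1] at hb
    exact (Commute.refl _).isUnit_mul_iff.1 hb |>.1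
  obtain ⟨s, hs⟩ := h2
  have h3 : star s = s := Units.ext (by
    rw [Units.coe_star, hs]
    exact (IsSelfAdjoint.of_nonneg (CFC.sqrt_nonneg _)).star_eq)
  refine ⟨↑s⁻¹, ?_, ?_⟩
  · rw [← Units.coe_star, star_inv, h3]
  · rw [← h1, ← hs]
    simp

/-- This is `w w* ≤ ‖w‖ ^ 2`, with a square root as witness because `IsHereditary` expresses the
order through elements `d* d`. -/
theorem exists_norm_sq_smul_sub_eq {A : Type*} [CStarAlgebra A] (w : A) :
    ∃ d : A, ((‖w‖ ^ 2 : ℝ) : ℂ) • (1 : A) - w * star w = star d * d := by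
  let := CStarAlgebra.spectralOrder A
  have := CStarAlgebra.spectralOrderedRing A
  have h : 0 ≤ algebraMap ℝ A (‖w‖ ^ 2) - w * star w :=
    sub_nonneg.2 (CStarAlgebra.mul_star_le_algebraMap_norm_sq)
  refine ⟨CFC.sqrt (algebraMap ℝ A (‖w‖ ^ 2) - w * star w), ?_⟩
  rw [(IsSelfAdjoint.of_nonneg (CFC.sqrt_nonneg (algebraMap ℝ A (‖w‖ ^ 2) - w * star w))).star_eq,
    CFC.sqrt_mul_sqrt_self _ h]
  rw [Algebra.algebraMap_eq_smul_one, Complex.coe_smul]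

/-- An algebra in which nonzero positive elements compress to invertible ones is purely infinite as
soon as it contains a proper isometry. -/
theorem isPurelyInfinite_of_exists_isUnit {A : Type*} [CStarAlgebra A]
    (h : ∀ a : A, a ≠ 0 → ∃ z, IsUnit (star z * (star a * a) * z))
    {s : A} (hs : star s * s = 1) (hs1 : s * star s ≠ 1) : IsPurelyInfinite A := by
  intro H hH hbot
  obtain ⟨a, ha, ha0⟩ : ∃ a ∈ H, a ≠ 0 := by
    by_contra! hcon
    refine hbot (le_bot_iff.1 fun a ha ↦ ?_)
    rw [hcon a ha]
    exact zero_mem _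
  -- Using `a*` makes the isometry `v = a* z g` start with `a*`. Then `v v*` is dominated by a
  -- multiple of `a* a`, which puts it in `H`.
  obtain ⟨z, hz⟩ := h (star a) (star_ne_zero.2 ha0)
  have hz' : star z * (star (star a) * star a) * z = star (star a * z) * (star a * z) := by
    simp only [star_mul, mul_assoc]
  obtain ⟨g, hg, hg1⟩ := exists_star_eq_mul_mul_eq_one (hz' ▸ hz)
  let v := star a * (z * g)
  have hv : star v * v = 1 := by
    rw [← hg1]
    simp only [v, star_mul, hg, mul_assoc]
  -- Conjugation by `v` carries 1 to `v v*` and the proper isometry `s` to `v s v*`, whose range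
  -- projection is a proper subprojection of `v v*`.
  refine ⟨v * star v, ?_, ⟨?_, ?_⟩, v * s * star v, ?_, ?_, ?_⟩
  · obtain ⟨d, hd⟩ := exists_norm_sq_smul_sub_eq (z * g)
    refine hH.mem_of_le _ (((‖z * g‖ ^ 2 : ℝ) : ℂ) • (star a * a))
      (SMulMemClass.smul_mem _ (mul_mem (star_mem ha) ha)) ⟨star v, by rw [star_star]⟩
      ⟨d * a, ?_⟩
    rw [star_mul d, mul_assoc (star a) (star d), ← mul_assoc (star d), ← hd]
    simp only [v, star_mul, star_star, sub_mul, mul_sub, smul_mul_assoc, one_mul, mul_smul_comm,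
      mul_assoc]
  · rw [IsIdempotentElem, mul_assoc, ← mul_assoc (star v), hv, one_mul]
  · rw [IsSelfAdjoint, star_mul, star_star]
  · calc star (v * s * star v) * (v * s * star v) = v * (star s * (star v * v) * s) * star v := by
          simp only [star_mul, star_star, mul_assoc]
      _ = v * star v := by rw [hv, mul_one, hs, mul_one]
  · calc v * star v * (v * s * star v * star (v * s * star v)) =
          v * (star v * v) * s * star v * star (v * s * star v) := by simp only [mul_assoc]
      _ = _ := by rw [hv, mul_one]
  · intro heq
    refine hs1 ?_
    calc s * star s = (star v * v) * s * (star v * v) * star s * (star v * v) := by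
          simp only [hv, mul_one, one_mul]
      _ = star v * (v * s * star v * star (v * s * star v)) * v := by
          simp only [star_mul, star_star, mul_assoc]
      _ = (star v * v) * (star v * v) := by rw [heq]; simp only [mul_assoc]
      _ = 1 := by rw [hv, mul_one]

/-- A `C*`-algebra with a unit element, as a unital `C*`-algebra. -/
noncomputable abbrev CStarAlgebra.ofUnit {A : Type*} [inst : NonUnitalCStarAlgebra A] (e : A)
    (h1 : ∀ a, e * a = a) (h2 : ∀ a, a * e = a) : CStarAlgebra A :=
  letI r : NormedRing A :=
    { (inferInstance : NonUnitalNormedRing A) with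
      one := e
      one_mul := h1
      mul_one := h2 }
  { r, (inferInstance : StarRing A), (inferInstance : CompleteSpace A) with
    toCStarRing := inst.toCStarRing
    toNormedAlgebra :=
      { Algebra.ofModule (R := ℂ) (A := A) smul_mul_assoc mul_smul_comm with
        norm_smul_le := norm_smul_le }
    toStarModule := inst.toStarModule }

/-! ### Characters of the infinite torus from prime factorizations. -/

/-- The character `χ ↦ ∏ χ_p ^ v_p(n)` of the infinite torus. -/
noncomputable def torusCharacter (n : ℕ) : (ℕ → Circle) →* Circle where
  toFun χ := n.factorization.prod fun p k ↦ χ p ^ k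
  map_one' := by simp [Finsupp.prod]
  map_mul' χ ψ := by simp [Finsupp.prod, mul_pow, Finset.prod_mul_distrib]

theorem torusCharacter_apply (n : ℕ) (χ : ℕ → Circle) :
    torusCharacter n χ = n.factorization.prod fun p k ↦ χ p ^ k := rfl

theorem continuous_torusCharacter (n : ℕ) : Continuous (torusCharacter n) := by
  change Continuous fun χ : ℕ → Circle ↦ n.factorization.prod fun p k ↦ χ p ^ k
  unfold Finsupp.prod
  fun_prop

@[simp] theorem torusCharacter_one : torusCharacter 1 = 1 := by
  ext χ
  simp [torusCharacter_apply]

theorem torusCharacter_mul {m n : ℕ} (hm : m ≠ 0) (hn : n ≠ 0) :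
    torusCharacter (m * n) = torusCharacter m * torusCharacter n := by
  refine MonoidHom.ext fun χ ↦ ?_
  rw [MonoidHom.mul_apply, torusCharacter_apply, Nat.factorization_mul hm hn]
  exact Finsupp.prod_add_index' (by simp) (by simp [pow_add])

/-- Rotation by the angle `π / (k - l)` gives `z ^ k = -z ^ l`. -/
theorem Circle.exists_pow_ne {k l : ℕ} (h : k ≠ l) : ∃ z : Circle, z ^ k ≠ z ^ l := by
  have h0 : (k : ℝ) - l ≠ 0 := sub_ne_zero.2 (by exact_mod_cast h)
  refine ⟨Circle.exp (Real.pi / (k - l)), fun heq ↦ ?_⟩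
  rw [← Circle.exp_nsmul, ← Circle.exp_nsmul] at heq
  have h1 : k • (Real.pi / ((k : ℝ) - l)) = l • (Real.pi / ((k : ℝ) - l)) + Real.pi := by
    simp only [nsmul_eq_mul]
    field_simp
    ring
  rw [h1, Circle.exp_add, mul_eq_left] at heq
  have h2 := congrArg (fun z : Circle ↦ (z : ℂ)) heq
  simp only [Circle.coe_exp, Complex.exp_pi_mul_I, Circle.coe_one] at h2
  norm_num at h2

/-- On the circle in coordinate `p` the character is `z ↦ z ^ v_p(n)`, which determines `v_p(n)`;
these valuations determine `n`. -/
theorem torusCharacter_injective {m n : ℕ} (hm : m ≠ 0) (hn : n ≠ 0)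
    (h : torusCharacter m = torusCharacter n) : m = n := by
  refine Nat.eq_of_factorization_eq hm hn fun p ↦ ?_
  by_contra hne
  obtain ⟨z, hz⟩ := Circle.exists_pow_ne hne
  have key : ∀ n, torusCharacter n (Pi.mulSingle p z) = z ^ n.factorization p := by
    intro n
    rw [torusCharacter_apply, Finsupp.prod, Finset.prod_eq_single p]
    · rw [Pi.mulSingle_eq_same]
    · intro q _ hq
      rw [Pi.mulSingle_eq_of_ne hq, one_pow]
    · intro hp
      rw [Finsupp.notMem_support_iff.1 hp, pow_zero]
  exact hz (by rw [← key, ← key, h])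

/-! ### Linearity of representations, the torus action, and the theorem. -/

namespace ProductSystem

section Linear

variable {P : Type v} [Monoid P] {E : ProductSystem.{u, v} P}

/-- Additivity is automatic: the difference `d` of the two sides satisfies `d* d = 0`, since all the
products involved are given by the inner product. -/
theorem IsRepresentation.map_add {B : Type*} [NonUnitalCStarAlgebra B] {φ : E.Total → B}
    (h : E.IsRepresentation φ) {s : P} (x y : E.Fiber s) :
    φ (of (x + y)) = φ (of x) + φ (of y) := by
  rw [← sub_eq_zero, ← CStarRing.star_mul_self_eq_zero_iff]
  simp only [star_sub, star_add, sub_mul, mul_sub, add_mul, mul_add, h.star_mul, inner_add_left,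
    inner_add_right, add_smul]
  abel

theorem IsRepresentation.map_smul {B : Type*} [NonUnitalCStarAlgebra B] {φ : E.Total → B}
    (h : E.IsRepresentation φ) {s : P} (c : ℂ) (x : E.Fiber s) :
    φ (of (c • x)) = c • φ (of x) := by
  rw [← sub_eq_zero, ← CStarRing.star_mul_self_eq_zero_iff]
  simp only [star_sub, star_smul, sub_mul, mul_sub, smul_mul_assoc, mul_smul_comm, h.star_mul,
    inner_smul_left, inner_smul_right, mul_smul, Complex.star_def]
  rw [smul_comm c]
  simp

/-- A representation as a linear map on a fiber. -/
def IsRepresentation.linearMap {B : Type*} [NonUnitalCStarAlgebra B] {φ : E.Total → B}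
    (h : E.IsRepresentation φ) (s : P) : E.Fiber s →ₗ[ℂ] B where
  toFun x := φ (of x)
  map_add' := h.map_add
  map_smul' := h.map_smul

theorem IsRepresentation.star_map_one {B : Type*} [NonUnitalCStarAlgebra B] {φ : E.Total → B}
    (h : E.IsRepresentation φ) : star (φ 1) = φ 1 := by
  have h1 : star (φ 1) * φ 1 = φ 1 := by
    have := h.star_mul E.one E.one
    rwa [inner_self_eq_norm_sq_to_K, norm_one, RCLike.ofReal_one, one_pow, one_smul] at this
  rw [← h1, StarMul.star_mul, star_star]

/-- The image of `1` is the identity of the algebra that a representation generates. -/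
theorem IsRepresentation.map_one_mul {B : Type*} [NonUnitalCStarAlgebra B] {φ : E.Total → B}
    (h : E.IsRepresentation φ)
    (hgen : (NonUnitalStarAlgebra.adjoin ℂ (Set.range φ)).topologicalClosure = ⊤) (a : B) :
    φ 1 * a = a ∧ a * φ 1 = a := by
  have hcl : IsClosed {a : B | φ 1 * a = a ∧ a * φ 1 = a} :=
    (isClosed_eq (by fun_prop) (by fun_prop)).inter (isClosed_eq (by fun_prop) (by fun_prop))
  have ha : a ∈ (NonUnitalStarAlgebra.adjoin ℂ (Set.range φ)).topologicalClosure :=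
    hgen ▸ trivial
  refine closure_minimal ?_ hcl ha
  intro b hb
  induction hb using NonUnitalStarAlgebra.adjoin_induction with
  | mem x hx =>
    obtain ⟨x, rfl⟩ := hx
    exact ⟨by rw [← h.map_mul, one_mul], by rw [← h.map_mul, mul_one]⟩
  | add x y _ _ hx hy => exact ⟨by rw [mul_add, hx.1, hy.1], by rw [add_mul, hx.2, hy.2]⟩
  | zero => exact ⟨mul_zero _, zero_mul _⟩
  | mul x y _ _ hx hy => exact ⟨by rw [← mul_assoc, hx.1], by rw [mul_assoc, hy.2]⟩
  | smul c x _ hx => exact ⟨by rw [mul_smul_comm, hx.1], by rw [smul_mul_assoc, hx.2]⟩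
  | star x _ hx =>
    refine ⟨?_, ?_⟩
    · rw [← h.star_map_one, ← StarMul.star_mul, hx.2]
    · rw [← h.star_map_one, ← StarMul.star_mul, hx.1]

theorem finrank_fiber_mul (s t : P) : Module.finrank ℂ (E.Fiber (s * t)) =
    Module.finrank ℂ (E.Fiber s) * Module.finrank ℂ (E.Fiber t) := by
  rw [← (E.mulIso s t).toLinearEquiv.finrank_eq, Module.finrank_tensorProduct]

theorem finrank_fiber_ne_zero (s : P) : Module.finrank ℂ (E.Fiber s) ≠ 0 :=
  Module.finrank_pos.ne'

/-- The character of the infinite torus by which it acts on a fiber. -/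
noncomputable def fiberCharacter (E : ProductSystem.{u, v} P) (s : P) : (ℕ → Circle) →* Circle :=
  torusCharacter (Module.finrank ℂ (E.Fiber s))

/-- The torus action on a Cuntz representation, as a single Cuntz representation in the algebra of
continuous functions on the torus. -/
noncomputable def gauge {B : Type*} [NonUnitalCStarAlgebra B] (φ : E.Total → B) (x : E.Total) :
    C(ℕ → Circle, B) where
  toFun χ := (E.fiberCharacter x.1 χ : ℂ) • φ x
  continuous_toFun := by
    have := continuous_torusCharacter (Module.finrank ℂ (E.Fiber x.1))
    unfold fiberCharacter
    fun_prop

theorem gauge_apply {B : Type*} [NonUnitalCStarAlgebra B] (φ : E.Total → B) (x : E.Total)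
    (χ : ℕ → Circle) : gauge φ x χ = (E.fiberCharacter x.1 χ : ℂ) • φ x := rfl

theorem gauge_one {B : Type*} [NonUnitalCStarAlgebra B] (φ : E.Total → B)
    (χ : ℕ → Circle) : gauge φ 1 χ = φ 1 := by
  rw [gauge_apply, fiberCharacter, show (1 : E.Total).1 = 1 from rfl, E.finrank_fiber_one]
  simp

/-- Dimensions multiply along the product, hence so do the characters; in the other two relations
each phase meets its conjugate. -/
theorem IsCuntzRepresentation.gauge {B : Type*} [NonUnitalCStarAlgebra B] {φ : E.Total → B}
    (h : E.IsCuntzRepresentation φ) : E.IsCuntzRepresentation (gauge φ) where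
  map_mul x y := by
    ext χ
    rw [ContinuousMap.mul_apply, gauge_apply, gauge_apply, gauge_apply, h.map_mul,
      smul_mul_smul_comm, ← Circle.coe_mul]
    congr 2
    change torusCharacter (Module.finrank ℂ (E.Fiber (x.1 * y.1))) χ = _
    rw [finrank_fiber_mul, torusCharacter_mul (finrank_fiber_ne_zero _) (finrank_fiber_ne_zero _)]
    rfl
  star_mul {s} x y := by
    ext χ
    rw [ContinuousMap.mul_apply, ContinuousMap.star_apply, ContinuousMap.smul_apply, gauge_one,
      gauge_apply, gauge_apply, star_smul, smul_mul_smul_comm, h.star_mul, Complex.star_def,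
      ← Circle.coe_inv_eq_conj, ← Circle.coe_mul]
    change ((_ * (E.fiberCharacter s χ) : Circle) : ℂ) • _ = _
    rw [show (of y).1 = s from rfl, inv_mul_cancel, Circle.coe_one, one_smul]
  sum_mul_star t b := by
    ext χ
    rw [ContinuousMap.sum_apply, gauge_one, ← h.sum_mul_star t b]
    refine Finset.sum_congr rfl fun i _ ↦ ?_
    rw [ContinuousMap.mul_apply, ContinuousMap.star_apply, gauge_apply, star_smul,
      smul_mul_smul_comm, Complex.star_def, ← Circle.coe_inv_eq_conj, ← Circle.coe_mul,
      mul_inv_cancel, Circle.coe_one, one_smul]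

end Linear

variable {P : Type v} [CommMonoid P] {E : ProductSystem.{u, v} P}

/-- The images of the fibers under a unital Cuntz representation. -/
noncomputable def IsCuntzRepresentation.hilbertSpaceSystem {B : Type w} [CStarAlgebra B]
    {φ : E.Total → B} (h : E.IsCuntzRepresentation φ) (h1 : φ 1 = 1) :
    HilbertSpaceSystem P B where
  space s := LinearMap.range (h.toIsRepresentation.linearMap s)
  dim s := Module.finrank ℂ (E.Fiber s)
  basis s i := φ (of (stdOrthonormalBasis ℂ (E.Fiber s) i))
  basis_mem s i := ⟨_, rfl⟩
  star_basis_mul_basis s i j := by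
    rw [h.star_mul, h1, (stdOrthonormalBasis ℂ (E.Fiber s)).inner_eq_ite, ite_smul, one_smul,
      zero_smul]
  sum_basis_mul_star s := by rw [h.sum_mul_star, h1]
  exists_scalar := by
    rintro s _ _ ⟨x, rfl⟩ ⟨y, rfl⟩
    exact ⟨⟪y, x⟫_ℂ, (h.star_mul x y).trans (by rw [h1])⟩
  mul_mem := by
    rintro s t _ _ ⟨x, rfl⟩ ⟨y, rfl⟩
    exact ⟨E.mulIso s t (x ⊗ₜ[ℂ] y), h.map_mul (of x) (of y)⟩

/-- An algebra with a universal unital Cuntz representation is simple, and purely infinite unless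
all fibers are indexed by `1`, if the dimension function is injective. -/
theorem IsUniversal.isSimple_and_isPurelyInfinite {O : Type w} [CStarAlgebra O] [Nontrivial O]
    {i : E.Total → O} (hi : IsUniversal.{u, v, w} E i) (h1 : i 1 = 1)
    (hdim : Function.Injective fun s : P ↦ Module.finrank ℂ (E.Fiber s)) :
    IsSimpleCStarAlgebra O ∧ (Nontrivial P → IsPurelyInfinite O) := by
  let H := hi.isCuntzRepresentation.hilbertSpaceSystem h1
  -- Universality gives the whole torus action as one homomorphism into `O`-valued continuous
  -- functions, so norm continuity of the orbits is built in.
  obtain ⟨δ, hδ⟩ := hi.exists_integratedForm C(ℕ → Circle, O) (gauge i)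
    hi.isCuntzRepresentation.gauge
  let : MeasurableSpace (ℕ → Circle) := borel _
  have : BorelSpace (ℕ → Circle) := ⟨rfl⟩
  let μ : MeasureTheory.Measure (ℕ → Circle) := MeasureTheory.Measure.haarMeasure ⊤
  have : MeasureTheory.IsProbabilityMeasure μ :=
    ⟨MeasureTheory.Measure.haarMeasure_self (K₀ := (⊤ : TopologicalSpace.PositiveCompacts _))⟩
  have hδH : ∀ {s x}, x ∈ H.space s → ∀ χ, δ x χ = (E.fiberCharacter s χ : ℂ) • x := by
    rintro s _ ⟨x, rfl⟩ χ
    exact congrArg (fun f : C(ℕ → Circle, O) ↦ f χ) (hδ (of x))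
  have hδ1 : ∀ a, δ a 1 = a := by
    let ev : O →⋆ₙₐ[ℂ] O :=
      { toFun := fun a ↦ δ a 1
        map_smul' := fun c a ↦ by rw [map_smul]; rfl
        map_zero' := by rw [map_zero]; rfl
        map_add' := fun a b ↦ by rw [map_add]; rfl
        map_mul' := fun a b ↦ by rw [map_mul]; rfl
        map_star' := fun a ↦ by rw [map_star]; rfl }
    intro a
    refine starHom_eq_on_closure ev (NonUnitalStarAlgHom.id ℂ O) (s := Set.range i) ?_
      (hi.generates ▸ trivial)
    rintro _ ⟨x, rfl⟩
    change δ (i x) 1 = i x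
    rw [hδ, gauge_apply, _root_.map_one, Circle.coe_one, one_smul]
  have key : ∀ a : O, a ≠ 0 → ∃ z, IsUnit (star z * (star a * a) * z) := fun a ha ↦
    H.exists_isUnit_star_mul_mul μ hδH hδ1
      (fun s t hst heq ↦ hst (hdim (torusCharacter_injective (finrank_fiber_ne_zero s)
        (finrank_fiber_ne_zero t) heq))) hdim
      (H.dense_algebraicSpan (S := Set.range i) (by rintro _ ⟨x, rfl⟩; exact ⟨x.1, x.2, rfl⟩)
        hi.generates) ha
  refine ⟨isSimpleCStarAlgebra_of_exists_isUnit key, fun hP ↦ ?_⟩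
  -- Since `dim E_1 = 1`, injectivity forces `dim E_s ≥ 2`. The range of one basis isometry is then
  -- orthogonal to that of another, so it is not everything.
  obtain ⟨s, hs⟩ := exists_ne (1 : P)
  have h2 : 1 < H.dim s := by
    have h3 : Module.finrank ℂ (E.Fiber s) ≠ 1 := by
      rw [← E.finrank_fiber_one]
      exact hdim.ne hs
    have h4 := finrank_fiber_ne_zero (E := E) s
    change 1 < Module.finrank ℂ (E.Fiber s)
    omega
  refine isPurelyInfinite_of_exists_isUnit key (s := H.basis s ⟨0, by omega⟩)
    (by simp [H.star_basis_mul_basis]) fun h ↦ ?_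
  have h5 : star (H.basis s ⟨1, h2⟩) * H.basis s ⟨1, h2⟩ = 0 := by
    conv_lhs => rw [← one_mul (H.basis s ⟨1, h2⟩), ← h]
    rw [mul_assoc, H.star_basis_mul_basis, if_neg (by simp), mul_zero, mul_zero]
  rw [H.star_basis_mul_basis, if_pos rfl] at h5
  exact one_ne_zero h5

end ProductSystem

/-- Let `P` be a submonoid of a countable abelian group `G` and `E` a product system over `P` of
finite-dimensional Hilbert spaces that admits a nontrivial Cuntz representation `φ`. If
`s ↦ dim E_s` is injective, then `𝓞_E` is simple and, unless `P = {1}` (where `𝓞_E ≅ ℂ`), purely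
infinite. -/
theorem mainTheorem1 {G : Type*} [CommGroup G] [Countable G] (P : Submonoid G)
    (E : ProductSystem P)
    {B : Type*} [NonUnitalCStarAlgebra B] (φ : E.Total → B)
    (hφ : E.IsCuntzRepresentation φ) (hφ0 : φ ≠ 0)
    (hdim : Function.Injective fun s : P ↦ Module.finrank ℂ (E.Fiber s)) :
    IsSimpleCStarAlgebra E.cuntzAlgebra ∧ (P ≠ ⊥ → IsPurelyInfinite E.cuntzAlgebra) := by
  have hone := E.isCuntzRepresentation_iE.toIsRepresentation.map_one_mul
    (ProductSystem.closure_adjoin_preimage E.directSum E.cuntzAlgebra rfl E.iE fun _ ↦ rfl)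
  -- If `i_E(1)` vanished, so would `φ 1`, and then every `φ x = φ 1 φ x`.
  have hne : E.iE 1 ≠ 0 := by
    intro h0
    obtain ⟨π, hπ⟩ := E.isUniversal_cuntzAlgebra.exists_integratedForm B φ hφ
    refine hφ0 (funext fun x ↦ ?_)
    rw [← one_mul x, hφ.map_mul, ← hπ 1, h0, map_zero, zero_mul]
    rfl
  have : Nontrivial E.cuntzAlgebra := ⟨_, _, hne⟩
  -- Only the unit is added; the norm, product and involution are the existing ones, so the unital
  -- result speaks about the same algebra.
  let : CStarAlgebra E.cuntzAlgebra :=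
    CStarAlgebra.ofUnit (E.iE 1) (fun a ↦ (hone a).1) fun a ↦ (hone a).2
  have h := ProductSystem.IsUniversal.isSimple_and_isPurelyInfinite
    (O := E.cuntzAlgebra) (i := E.iE) E.isUniversal_cuntzAlgebra rfl hdim
  exact ⟨h.1, fun hP ↦ h.2 (P.bot_or_nontrivial.resolve_left hP)⟩
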